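/- Let $n\ge 1$ and let $P=\{x\in\mathbb R^n: Ax\le b\}$, $A\in\mathbb R^{m\times n}$ with rows $a_1,\dots,a_m$, $b\in\mathbb R^m$, be pointed ($A$ has full column rank). A basis is a list $B$ of $n$ indices with $(a_i)_{i\in B}$ linearly independent; it is feasible if the point $x$ with $\langle a_i,x\rangle=b_i$ for all $i\in B$ lies in $P$, and optimal for $c\in\mathbb R^n$ if moreover $c\in\operatorname{cone}(a_i:i\in B)$. The normal cone at a vertex $v$ of $P$ is generated by the rows $a_i$ with $\langle a_i,v\rangle=b_i$; the normal fan is the collection of the normal cones at the vertices, and its support $N(P)$ is their union. A triangulation of the normal fan is a finite set $\mathcal T$ of simplicial $n$-dimensional cones with union $N(P)$ (a closed cone), any two of which meet in a common face, such that each is generated by some of the rows $a_i$ that are tight at one vertex of $P$. Write $\partial\mathcal T=\bigcup_{C\in\mathcal T}\partial C$. The shadow simplex method with symbolic perturbation, for input $A,b,c,d$ and an initial basis $B$, is the following. Number the rows so that those in $B$ come last and replace $b_j$ by $b_j+\varepsilon^j$, where elements of $\mathbb R[\varepsilon]$ are compared by their values for all sufficiently small $\varepsilon>0$ (and stored as sorted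 lists of monomials). By column operations $A\gets AU$, $c\gets U^Tc$, $d\gets U^Td$ achieve $A_B=I_n$. Then repeat: let $i^\star$ minimize $\frac{c_i}{c_i-d_i}$ over the $i$ with $c_i>d_i$; if $i^\star$ does not exist or the minimum is at least $1$, return $B$; otherwise let $j^\star$ minimize $\big(\langle a_j,b_B+(\varepsilon^k)_{k\in B}\rangle-b_j-\varepsilon^j\big)/a_{ji^\star}$ over the $j\notin B$ with $a_{ji^\star}<0$, replace the $i^\star$-th element of $B$ by $j^\star$, and restore $A_B=I_n$ by column operations. There is an absolute constant $K$ such that the following holds. For every feasible basis $B$ of $P$ there is a triangulation $\mathcal T$ of the normal fan of $P$ that contains $\operatorname{cone}(a_i:i\in B)$, such that for all $c,d\in\mathbb R^n$ for which - $B$ is an optimal basis for $c$ and $d\in N(P)$, and - every point in which $[c,d)$ meets a facet $F$ of a cone spanned by a feasible basis of $P$ lies in the relative interior of $F$, the shadow simplex method with symbolic perturbation, started from $B$, terminates and returns an optimal basis for $d$ after at most $K\,(mn^2+Nmn)$ arithmetic operations (comparisons included), where $N$ is the number of intersections of $[c,d]$ with $\mathcal T$. The bound holds both for $N=|[c,d]\cap\partial\mathcal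 T|$ and for $N$ the number of facets of cones of $\mathcal T$ that meet $[c,d]$. -/

import Mathlib

namespace ShadowSimplex

/-! ## Counting operations

A computation returns a value together with the number of elementary operations it used. The
algorithm below is written over an abstract type `S` of scalars, which it can only access through
the operations of `Scalar S`, so every arithmetic operation and every comparison of scalars is
counted. Comparisons of indices and of exponents are counted as well. -/

/-- A value together with the number of operations spent on computing it. -/
structure Cost (α : Type) where
  val : α
  ticks : ℕ

namespace Cost

instance : Monad Cost where
  pure a := ⟨a, 0⟩
  bind x f := ⟨(f x.val).val, x.ticks + (f x.val).ticks⟩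

/-- A value obtained by one operation. -/
def tick {α : Type} (a : α) : Cost α := ⟨a, 1⟩

/-- Compute all entries of a table; the costs of the entries add up. -/
def tabulate {α : Type} {k : ℕ} (f : Fin k → Cost α) : Cost (Fin k → α) :=
  ⟨fun i => (f i).val, ∑ i, (f i).ticks⟩

end Cost

/-- Scalars with the field operations and comparison as counted operations. -/
class Scalar (S : Type) where
  zero : S
  one : S
  add : S → S → Cost S
  sub : S → S → Cost S
  mul : S → S → Cost S
  div : S → S → Cost S
  lt : S → S → Cost Bool

/-- Exact real arithmetic, each operation at unit cost. -/
noncomputable instance : Scalar ℝ where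
  zero := 0
  one := 1
  add x y := Cost.tick (x + y)
  sub x y := Cost.tick (x - y)
  mul x y := Cost.tick (x * y)
  div x y := Cost.tick (x / y)
  lt x y := Cost.tick (decide (x < y))

/-! ## Searching and sorting -/

/-- The first element of a list that passes a test. -/
def findFirst {α : Type} (test : α → Cost Bool) : List α → Cost (Option α)
  | [] => pure none
  | a :: l => do
    if (← test a) then
      pure (some a)
    else
      findFirst test l

/-- The element of a list with the smallest key (the first one in case of ties), together with its
key, where elements with key `none` are skipped and `best` is the best element found so far. -/
def argmin {α κ : Type} (key : α → Cost (Option κ)) (lt : κ → κ → Cost Bool) :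
    List α → Option (α × κ) → Cost (Option (α × κ))
  | [], best => pure best
  | a :: l, best => do
    match (← key a) with
    | none => argmin key lt l best
    | some v =>
      match best with
      | none => argmin key lt l (some (a, v))
      | some (a₀, v₀) => do
        if (← lt v v₀) then
          argmin key lt l (some (a, v))
        else
          argmin key lt l (some (a₀, v₀))

/-- Insert an element into a list that is sorted by `e`. -/
def insertBy {α : Type} (e : α → ℕ) (a : α) : List α → Cost (List α)
  | [] => pure [a]
  | x :: l => do
    if (← Cost.tick (decide (e a < e x))) then
      pure (a :: x :: l)
    else do
      let r ← insertBy e a l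
      pure (x :: r)

/-- Insertion sort. -/
def sortBy {α : Type} (e : α → ℕ) : List α → Cost (List α)
  | [] => pure []
  | x :: l => do
    let r ← sortBy e l
    insertBy e x r

/-! ## Polynomials in the infinitesimal `ε` -/

/-- A polynomial in `ε` as the list of its monomials (exponent, coefficient), with strictly
increasing exponents. -/
abbrev SparsePoly (S : Type) := List (ℕ × S)

/-- Decide by the sign of `x`: `true` if `x < 0`, `false` if `0 < x`, and `rest` if `x = 0`. -/
def isNegOr {S : Type} [Scalar S] (x : S) (rest : Cost Bool) : Cost Bool := do
  if (← Scalar.lt x Scalar.zero) then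
    pure true
  else do
    if (← Scalar.lt Scalar.zero x) then
      pure false
    else
      rest

/-- Decide by the sign of `x`: `true` if `0 < x`, `false` if `x < 0`, and `rest` if `x = 0`. -/
def isPosOr {S : Type} [Scalar S] (x : S) (rest : Cost Bool) : Cost Bool := do
  if (← Scalar.lt Scalar.zero x) then
    pure true
  else do
    if (← Scalar.lt x Scalar.zero) then
      pure false
    else
      rest

/-- The lexicographic order: `p < q` iff `p(ε) < q(ε)` for all sufficiently small `ε > 0`. -/
def polyLt {S : Type} [Scalar S] : SparsePoly S → SparsePoly S → Cost Bool
  | [], [] => pure false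
  | [], (_, y) :: q => isPosOr y (polyLt [] q)
  | (_, x) :: p, [] => isNegOr x (polyLt p [])
  | (e, x) :: p, (f, y) :: q => do
    if (← Cost.tick (decide (e < f))) then
      isNegOr x (polyLt p ((f, y) :: q))
    else do
      if (← Cost.tick (decide (f < e))) then
        isPosOr y (polyLt ((e, x) :: p) q)
      else do
        if (← Scalar.lt x y) then
          pure true
        else do
          if (← Scalar.lt y x) then
            pure false
          else
            polyLt p q
termination_by p q => p.length + q.length

/-! ## The algorithm -/

/-- The transformed constraint matrix and the two transformed objectives. -/
structure Tableau (S : Type) (m n : ℕ) where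
  A : Fin m → Fin n → S
  c : Fin n → S
  d : Fin n → S

/-- The column operation that turns the row `p` into the `k`-th unit vector, applied to the
row `r`. -/
def eliminateRow {S : Type} [Scalar S] {n : ℕ} (p : Fin n → S) (k : Fin n) (r : Fin n → S) :
    Cost (Fin n → S) := do
  let q ← Scalar.div (r k) (p k)
  Cost.tabulate fun l => do
    if (← Cost.tick (decide (l = k))) then
      pure q
    else do
      let t ← Scalar.mul (p l) q
      Scalar.sub (r l) t

/-- Gauss elimination step `A ← A U`, `c ← Uᵀ c`, `d ← Uᵀ d` that turns row `j` of `A` into the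
`k`-th unit vector. -/
def eliminate {S : Type} [Scalar S] {m n : ℕ} (τ : Tableau S m n) (j : Fin m) (k : Fin n) :
    Cost (Tableau S m n) := do
  let A' ← Cost.tabulate fun i => eliminateRow (τ.A j) k (τ.A i)
  let c' ← eliminateRow (τ.A j) k τ.c
  let d' ← eliminateRow (τ.A j) k τ.d
  pure ⟨A', c', d'⟩

/-- Exchange two columns. -/
def swapColumns {S : Type} {m n : ℕ} (τ : Tableau S m n) (k l : Fin n) : Tableau S m n where
  A i := τ.A i ∘ Equiv.swap k l
  c := τ.c ∘ Equiv.swap k l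
  d := τ.d ∘ Equiv.swap k l

/-- Test whether a scalar is non-zero. -/
def isNonzero {S : Type} [Scalar S] (x : S) : Cost Bool := do
  if (← Scalar.lt x Scalar.zero) then
    pure true
  else
    Scalar.lt Scalar.zero x

/-- Gauss elimination by column operations so that `A_B = I`, where `B = (β 0, β 1, …)`. (A pivot
column is always found if the rows in `B` are linearly independent.) -/
def gauss {S : Type} [Scalar S] {m n : ℕ} (β : Fin n → Fin m) (τ : Tableau S m n) :
    Cost (Tableau S m n) :=
  (List.finRange n).foldlM (fun τ k => do
    match (← findFirst (fun l => isNonzero (τ.A (β k) l))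
        ((List.finRange n).filter fun l => k ≤ l)) with
    | none => pure τ
    | some l => eliminate (swapColumns τ k l) (β k) k) τ

/-- The position of the row `j` in the basis, if there is one. -/
def position {m n : ℕ} (β : Fin n → Fin m) (j : Fin m) : Cost (Option (Fin n)) :=
  findFirst (fun k => Cost.tick (decide (β k = j))) (List.finRange n)

/-- The exponents of the perturbation: the rows are numbered `1, …, m` in such a way that the rows
outside of the initial basis come first, in their original order, and the basis rows last; the
right-hand side of the row with number `e` is perturbed by `ε ^ e`. -/
def perturbation {m n : ℕ} (β : Fin n → Fin m) : Cost (Fin m → ℕ) := do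
  let s ← (List.finRange m).foldlM (fun (s : ℕ × (Fin m → ℕ)) j => do
    match (← position β j) with
    | some k => pure (s.1, Function.update s.2 j (m - n + k + 1))
    | none => do
      let i ← Cost.tick (s.1 + 1)
      pure (i, Function.update s.2 j i)) (0, fun _ => 0)
  pure s.2

/-- The index `i⋆` with smallest ratio `c i / (c i - d i)` among those with `c i > d i`, together
with this ratio `λ⋆`. -/
def leaving {S : Type} [Scalar S] {m n : ℕ} (τ : Tableau S m n) : Cost (Option (Fin n × S)) :=
  argmin (fun i => do
      if (← Scalar.lt (τ.d i) (τ.c i)) then do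
        let s ← Scalar.sub (τ.c i) (τ.d i)
        let r ← Scalar.div (τ.c i) s
        pure (some r)
      else
        pure none)
    Scalar.lt (List.finRange n) none

/-- The polynomial `(⟨a_j, b_B + γ_B⟩ - b_j - γ_j) / a_{j i}`, where `γ_j = ε ^ e j`. The list
`ord` holds the positions of the basis sorted by exponents. -/
def ratio {S : Type} [Scalar S] {m n : ℕ} (b : Fin m → S) (e : Fin m → ℕ) (β : Fin n → Fin m)
    (ord : List (Fin n)) (τ : Tableau S m n) (i : Fin n) (j : Fin m) : Cost (SparsePoly S) := do
  let s ← (List.finRange n).foldlM (fun s k => do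
    let t ← Scalar.mul (τ.A j k) (b (β k))
    Scalar.add s t) Scalar.zero
  let t ← Scalar.sub s (b j)
  let u ← Scalar.sub Scalar.zero Scalar.one
  let p ← insertBy Prod.fst (e j, u) (ord.map fun k => (e (β k), τ.A j k))
  ((0, t) :: p).mapM fun x => do
    let y ← Scalar.div x.2 (τ.A j i)
    pure (x.1, y)

/-- The index `j⋆` with smallest `ratio` among the `j ∉ B` with `a_{j i} < 0`. -/
def entering {S : Type} [Scalar S] {m n : ℕ} (b : Fin m → S) (e : Fin m → ℕ) (β : Fin n → Fin m)
    (τ : Tableau S m n) (i : Fin n) : Cost (Option (Fin m × SparsePoly S)) := do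
  let ord ← sortBy (fun k => e (β k)) (List.finRange n)
  argmin (fun j => do
      match (← position β j) with
      | some _ => pure none
      | none => do
        if (← Scalar.lt (τ.A j i) Scalar.zero) then do
          let p ← ratio b e β ord τ i j
          pure (some p)
        else
          pure none)
    polyLt (List.finRange m) none

/-- The current (ordered) basis and the tableau with `A_B = I`. -/
structure State (S : Type) (m n : ℕ) where
  basis : Fin n → Fin m
  tableau : Tableau S m n

/-- The outcome of one iteration of the main loop. -/
inductive Outcome (S : Type) (m n : ℕ) where
  | optimal (β : Fin n → Fin m)
  | unbounded
  | next (s : State S m n)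

/-- One iteration of the main loop. (The parameter `λ` of the current objective `(1-λ) c + λ d` is
never read by the method, so it is not stored.) -/
def iteration {S : Type} [Scalar S] {m n : ℕ} (b : Fin m → S) (e : Fin m → ℕ) (s : State S m n) :
    Cost (Outcome S m n) := do
  match (← leaving s.tableau) with
  | none => pure (.optimal s.basis)
  | some (i, r) => do
    if (← Scalar.lt r Scalar.one) then
      match (← entering b e s.basis s.tableau i) with
      | none => pure .unbounded
      | some (j, _) => do
        let τ ← eliminate s.tableau j i
        pure (.next ⟨Function.update s.basis i j, τ⟩)
    else
      pure (.optimal s.basis)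

/-- `Loop b e s β t`: the main loop, started in the state `s`, terminates and returns the basis
`β` after `t` operations. -/
inductive Loop {S : Type} [Scalar S] {m n : ℕ} (b : Fin m → S) (e : Fin m → ℕ) :
    State S m n → (Fin n → Fin m) → ℕ → Prop
  | halt {s : State S m n} {β : Fin n → Fin m} {t : ℕ} :
      iteration b e s = ⟨.optimal β, t⟩ → Loop b e s β t
  | step {s s' : State S m n} {β : Fin n → Fin m} {t t' : ℕ} :
      iteration b e s = ⟨.next s', t⟩ → Loop b e s' β t' → Loop b e s β (t + t')

/-- Everything before the main loop: the exponents of the perturbation and the initial Gauss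
elimination. -/
def setup {S : Type} [Scalar S] {m n : ℕ} (A : Fin m → Fin n → S) (c d : Fin n → S)
    (β : Fin n → Fin m) : Cost ((Fin m → ℕ) × State S m n) := do
  let e ← perturbation β
  let τ ← gauss β ⟨A, c, d⟩
  pure (e, ⟨β, τ⟩)

/-- The shadow simplex method with symbolic perturbation, on input `A`, `b`, `c`, `d` and the
initial basis `β`, terminates and returns the basis `β'` after `t` operations. -/
def Computes {S : Type} [Scalar S] {m n : ℕ} (A : Fin m → Fin n → S) (b : Fin m → S)
    (c d : Fin n → S) (β β' : Fin n → Fin m) (t : ℕ) : Prop :=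
  ∃ t', Loop b (setup A c d β).val.1 (setup A c d β).val.2 β' t' ∧
    t = (setup A c d β).ticks + t'

/-! ## Polyhedra, bases and normal fans -/

open scoped Matrix

/-- The polyhedron `A x ≤ b`. -/
def polyhedron {m n : ℕ} (A : Matrix (Fin m) (Fin n) ℝ) (b : Fin m → ℝ) : Set (Fin n → ℝ) :=
  {x | ∀ i, A i ⬝ᵥ x ≤ b i}

/-- The indices of the constraints that are tight at `v`. -/
def tight {m n : ℕ} (A : Matrix (Fin m) (Fin n) ℝ) (b : Fin m → ℝ) (v : Fin n → ℝ) :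
    Set (Fin m) :=
  {i | A i ⬝ᵥ v = b i}

/-- The vertices of the polyhedron. -/
def vertices {m n : ℕ} (A : Matrix (Fin m) (Fin n) ℝ) (b : Fin m → ℝ) : Set (Fin n → ℝ) :=
  (polyhedron A b).extremePoints ℝ

/-- The normal cone at `v`, generated by the rows of the tight constraints. -/
def normalCone {m n : ℕ} (A : Matrix (Fin m) (Fin n) ℝ) (b : Fin m → ℝ) (v : Fin n → ℝ) :
    PointedCone ℝ (Fin n → ℝ) :=
  PointedCone.hull ℝ ((fun i => A i) '' tight A b v)

/-- The support `N(P)` of the normal fan: the union of the normal cones at the vertices. -/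
def normalFanSupport {m n : ℕ} (A : Matrix (Fin m) (Fin n) ℝ) (b : Fin m → ℝ) :
    Set (Fin n → ℝ) :=
  ⋃ v ∈ vertices A b, (normalCone A b v : Set (Fin n → ℝ))

/-- `β` lists the `n` elements of a feasible basis: the rows are linearly independent, and the
point where these constraints are tight belongs to the polyhedron. -/
def IsFeasibleBasis {m n : ℕ} (A : Matrix (Fin m) (Fin n) ℝ) (b : Fin m → ℝ)
    (β : Fin n → Fin m) : Prop :=
  LinearIndependent ℝ (fun k => A (β k)) ∧ ∃ x ∈ polyhedron A b, ∀ k, A (β k) ⬝ᵥ x = b (β k)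

/-- The cone spanned by the rows of a basis. -/
def basisCone {m n : ℕ} (A : Matrix (Fin m) (Fin n) ℝ) (β : Fin n → Fin m) :
    PointedCone ℝ (Fin n → ℝ) :=
  PointedCone.hull ℝ (Set.range fun k => A (β k))

/-- `β` is an optimal basis for `max {⟨c, x⟩ : A x ≤ b}`. -/
def IsOptimalBasis {m n : ℕ} (A : Matrix (Fin m) (Fin n) ℝ) (b : Fin m → ℝ) (c : Fin n → ℝ)
    (β : Fin n → Fin m) : Prop :=
  IsFeasibleBasis A b β ∧ c ∈ basisCone A β

/-! ## Cone partitions and triangulations -/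

/-- `F` is a facet of the `n`-dimensional cone `C`, i.e. an `(n - 1)`-dimensional face. -/
def IsFacet {n : ℕ} (F C : PointedCone ℝ (Fin n → ℝ)) : Prop :=
  F.IsFaceOf C ∧ Module.finrank ℝ (Submodule.span ℝ (F : Set (Fin n → ℝ))) + 1 = n

/-- The union of the cones of a set of cones. -/
def support {n : ℕ} (T : Set (PointedCone ℝ (Fin n → ℝ))) : Set (Fin n → ℝ) :=
  ⋃ C ∈ T, (C : Set (Fin n → ℝ))

/-- An `n`-dimensional cone partition. -/
structure IsConePartition {n : ℕ} (T : Set (PointedCone ℝ (Fin n → ℝ))) : Prop where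
  finite : T.Finite
  isClosed : ∀ C ∈ T, IsClosed (C : Set (Fin n → ℝ))
  full_dim : ∀ C ∈ T, Submodule.span ℝ (C : Set (Fin n → ℝ)) = ⊤
  face : ∀ C ∈ T, ∀ C' ∈ T, C ≠ C' → (C ⊓ C').IsFaceOf C ∧ (C ⊓ C').IsFaceOf C'
  support_closed : ∃ N : PointedCone ℝ (Fin n → ℝ),
    (N : Set (Fin n → ℝ)) = support T ∧ IsClosed (N : Set (Fin n → ℝ))

/-- `T` is a triangulation of the normal fan of `A x ≤ b`: a partition into simplicial cones with
the same support, each of them generated by some of the generators of a normal cone. -/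
structure IsNormalFanTriangulation {m n : ℕ} (A : Matrix (Fin m) (Fin n) ℝ) (b : Fin m → ℝ)
    (T : Set (PointedCone ℝ (Fin n → ℝ))) : Prop extends IsConePartition T where
  simplicial : ∀ C ∈ T, C.IsSimplicial
  support_eq : support T = normalFanSupport A b
  generated : ∀ C ∈ T, ∃ v ∈ vertices A b, ∃ I ⊆ tight A b v,
    C = PointedCone.hull ℝ ((fun i => A i) '' I)

/-- The points where the segment `[c, d]` meets the boundary `∂T = ⋃_{C ∈ T} ∂C`. -/
def crossingPoints {n : ℕ} (T : Set (PointedCone ℝ (Fin n → ℝ))) (c d : Fin n → ℝ) :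
    Set (Fin n → ℝ) :=
  segment ℝ c d ∩ ⋃ C ∈ T, frontier (C : Set (Fin n → ℝ))

/-- The facets of `T` that are met by the segment `[c, d]`. -/
def crossedFacets {n : ℕ} (T : Set (PointedCone ℝ (Fin n → ℝ))) (c d : Fin n → ℝ) :
    Set (PointedCone ℝ (Fin n → ℝ)) :=
  {F | (∃ C ∈ T, IsFacet F C) ∧ (segment ℝ c d ∩ (F : Set (Fin n → ℝ))).Nonempty}

/-- Every intersection of the half-open segment `[c, d)` with a facet of a cone spanned by a
feasible basis lies in the relative interior of this facet. -/
def InGeneralPosition {m n : ℕ} (A : Matrix (Fin m) (Fin n) ℝ) (b : Fin m → ℝ)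
    (c d : Fin n → ℝ) : Prop :=
  ∀ β : Fin n → Fin m, IsFeasibleBasis A b β →
    ∀ F : PointedCone ℝ (Fin n → ℝ), IsFacet F (basisCone A β) →
      ∀ x ∈ segment ℝ c d, x ≠ d → x ∈ F → x ∈ intrinsicInterior ℝ (F : Set (Fin n → ℝ))

end ShadowSimplex

/-! The symbolic perturbation is replaced by an actual one. The exponents are distinct and positive,
and those of the initial basis are the largest. Hence four things hold for all sufficiently small `ε
> 0`: the polynomials met in ratio tests are ordered like their values at `ε` (`polyLt_iff`,
`eventually_comparesAt`), the initial basis stays feasible, every basis feasible for the perturbed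
right-hand side is feasible for `b`, and the perturbed system is nondegenerate. One such `ε` is
fixed. It depends on `A`, `b` and the initial basis but not on `c` and `d`, and the method behaves
as the ordinary shadow simplex method on the perturbed system.

The triangulation consists of the cones of the bases feasible for the perturbed system. A basic
point maximizes every objective in the cone of its basis. If an objective is maximized at two basic
points, complementary slackness and nondegeneracy put the rows it needs into both bases, so the
cones meet in common faces (`inf_isFaceOf_basisCone`). The cones cover the cone of all rows, because
a feasible basis of largest objective value admits no improving pivot (`exists_isOptimalBasis`). The
support of the normal fan lies between these two sets, so all three agree.

A tableau with `A_B = I` holds the coordinates of the rows, of `c` and of `d` with respect to the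
basis (`coord`), and the cone of the basis is the nonnegative orthant in these coordinates. The
leaving index is the coordinate that first vanishes on the segment, i.e. the facet through which the
segment leaves the cone; the ratio test finds a feasible basis on the other side, and it cannot fail
as `d` lies in the cone of the rows. By general position the crossing point is in the relative
interior of the facet. So in the new basis all other coordinates are positive there, while the
exchanged one now increases along the segment, and the next crossing has a strictly larger parameter
(`exists_loop`). Hence pivots inject into crossing points and into crossed facets
(`card_le_crossingPoints`, `card_le_crossedFacets`). A pivot costs `O(mn)` and the setup `O(mn²)`.
-/

namespace ShadowSimplex

/-! ### Values and costs of composed computations -/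

namespace Cost

variable {α β : Type}

@[ext] theorem ext {x y : Cost α} (h : x.val = y.val) (h' : x.ticks = y.ticks) : x = y := by
  cases x; cases y; simp_all

@[simp] theorem val_pure (a : α) : (pure a : Cost α).val = a := rfl
@[simp] theorem ticks_pure (a : α) : (pure a : Cost α).ticks = 0 := rfl
@[simp] theorem val_bind (x : Cost α) (f : α → Cost β) : (x >>= f).val = (f x.val).val := rfl
@[simp] theorem ticks_bind (x : Cost α) (f : α → Cost β) :
    (x >>= f).ticks = x.ticks + (f x.val).ticks := rfl
@[simp] theorem val_tick (a : α) : (tick a).val = a := rfl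
@[simp] theorem ticks_tick (a : α) : (tick a).ticks = 1 := rfl
@[simp] theorem val_tabulate {k : ℕ} (f : Fin k → Cost α) (i : Fin k) :
    (tabulate f).val i = (f i).val := rfl
@[simp] theorem ticks_tabulate {k : ℕ} (f : Fin k → Cost α) :
    (tabulate f).ticks = ∑ i, (f i).ticks := rfl

theorem ticks_tabulate_le {k T : ℕ} (f : Fin k → Cost α) (h : ∀ i, (f i).ticks ≤ T) :
    (tabulate f).ticks ≤ k * T := by
  simpa using Finset.sum_le_card_nsmul Finset.univ (fun i => (f i).ticks) T (fun i _ => h i)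

instance : LawfulMonad Cost := LawfulMonad.mk'
  (id_map := fun x => by ext <;> simp [Functor.map])
  (pure_bind := fun a f => by ext <;> simp)
  (bind_assoc := fun x f g => by ext <;> simp [Nat.add_assoc])

/-- Invariants of a loop over a list, with a bound on its cost. -/
theorem foldlM_induction {σ : Type} (f : σ → α → Cost σ) (T : ℕ) (l : List α)
    (motive : List α → σ → Prop) (s : σ) (h0 : motive [] s)
    (hstep : ∀ l₁ a l₂ s, l = l₁ ++ a :: l₂ → motive l₁ s →
      motive (l₁ ++ [a]) (f s a).val ∧ (f s a).ticks ≤ T) :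
    motive l (l.foldlM f s).val ∧ (l.foldlM f s).ticks ≤ l.length * T := by
  suffices H : ∀ l₂ l₁ s, l = l₁ ++ l₂ → motive l₁ s →
      motive l (l₂.foldlM f s).val ∧ (l₂.foldlM f s).ticks ≤ l₂.length * T from
    H l [] s rfl h0
  intro l₂
  induction l₂ with
  | nil => intro l₁ s h hm; simp_all
  | cons a l₂ ih =>
    intro l₁ s h hm
    obtain ⟨h1, h2⟩ := hstep l₁ a l₂ s h hm
    obtain ⟨h3, h4⟩ := ih (l₁ ++ [a]) (f s a).val (by simp [h]) h1
    refine ⟨by simpa using h3, ?_⟩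
    simp only [List.foldlM_cons, ticks_bind, List.length_cons]
    linarith

@[simp] theorem val_map (f : α → β) (x : Cost α) : (f <$> x).val = f x.val := rfl
@[simp] theorem ticks_map (f : α → β) (x : Cost α) : (f <$> x).ticks = x.ticks := rfl

theorem mapM_val {f : α → Cost β} (l : List α) : (l.mapM f).val = l.map fun a => (f a).val := by
  induction l with
  | nil => simp
  | cons a l ih => simp [ih]

theorem mapM_ticks_le {f : α → Cost β} {T : ℕ} (h : ∀ a, (f a).ticks ≤ T) (l : List α) :
    (l.mapM f).ticks ≤ l.length * T := by
  induction l with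
  | nil => simp
  | cons a l ih => have := h a; simp; linarith

end Cost

/-! ### Correctness and cost of searching and sorting -/

theorem findFirst_val {α : Type} (test : α → Cost Bool) (l : List α) :
    (findFirst test l).val = l.find? fun a => (test a).val := by
  induction l with
  | nil => simp [findFirst]
  | cons a l ih => cases h : (test a).val <;> simp [findFirst, h, ih]

theorem findFirst_ticks_le {α : Type} {test : α → Cost Bool} {T : ℕ}
    (h : ∀ a, (test a).ticks ≤ T) (l : List α) : (findFirst test l).ticks ≤ l.length * T := by
  induction l with
  | nil => simp [findFirst]
  | cons a l ih =>
    have := h a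
    cases h : (test a).val <;> simp [findFirst, h] <;> nlinarith

section argmin

variable {α κ : Type} {key : α → Cost (Option κ)} {lt : κ → κ → Cost Bool}

theorem argmin_eq_none {l : List α} {best : Option (α × κ)} (h : (argmin key lt l best).val = none) :
    best = none ∧ ∀ a ∈ l, (key a).val = none := by
  induction l generalizing best with
  | nil => simpa [argmin] using h
  | cons a l ih =>
    cases hk : (key a).val with
    | none =>
      simp only [argmin, Cost.val_bind, hk] at h
      simpa [hk] using ih h
    | some v =>
      rcases best with _ | ⟨a₀, v₀⟩
      · simp only [argmin, Cost.val_bind, hk] at h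
        simpa using (ih h).1
      · simp only [argmin, Cost.val_bind, hk] at h
        split_ifs at h <;> simpa using (ih h).1

/-- The comparison need only agree with the real order of `φ` on `good` keys. For the ratio test the
keys are polynomials, `φ` is evaluation at a fixed `ε`, and the good keys are the finitely many
ratios for which `ε` is small enough. -/
theorem argmin_eq_some {good : κ → Prop} {φ : κ → ℝ} {l : List α}
    (hgood : ∀ a ∈ l, ∀ v, (key a).val = some v → good v)
    (hlt : ∀ v w, good v → good w → ((lt v w).val = true ↔ φ v < φ w))
    {best : Option (α × κ)} (hbest : ∀ p, best = some p → good p.2) {a : α} {v : κ}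
    (h : (argmin key lt l best).val = some (a, v)) :
    (best = some (a, v) ∨ a ∈ l ∧ (key a).val = some v) ∧
      (∀ a' ∈ l, ∀ v', (key a').val = some v' → φ v ≤ φ v') ∧
      ∀ p, best = some p → φ v ≤ φ p.2 := by
  induction l generalizing best with
  | nil => simp [argmin] at h; simp [h]
  | cons x l ih =>
    have hl : ∀ a ∈ l, ∀ v, (key a).val = some v → good v :=
      fun a ha => hgood a (List.mem_cons_of_mem _ ha)
    have hx := hgood x List.mem_cons_self
    simp only [List.mem_cons, forall_eq_or_imp]
    cases hk : (key x).val with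
    | none =>
      simp only [argmin, Cost.val_bind, hk] at h
      obtain ⟨h1, h2, h3⟩ := ih hl hbest h
      refine ⟨by tauto, ⟨by simp, h2⟩, h3⟩
    | some w =>
      have hw := hx w hk
      rcases best with _ | ⟨a₀, v₀⟩
      · simp only [argmin, Cost.val_bind, hk] at h
        obtain ⟨h1, h2, h3⟩ := ih hl (by simpa using hw) h
        refine ⟨?_, ⟨by simpa using h3, h2⟩, by simp⟩
        rcases h1 with h1 | h1
        · simp only [Option.some.injEq, Prod.mk.injEq] at h1
          obtain ⟨rfl, rfl⟩ := h1
          exact .inr ⟨.inl rfl, hk⟩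
        · exact .inr ⟨.inr h1.1, h1.2⟩
      · have hv₀ : good v₀ := hbest _ rfl
        simp only [argmin, Cost.val_bind, hk] at h
        split_ifs at h with hc
        · rw [hlt _ _ hw hv₀] at hc
          obtain ⟨h1, h2, h3⟩ := ih hl (by simpa using hw) h
          have h3 : φ v ≤ φ w := by simpa using h3
          refine ⟨?_, ⟨by simpa using h3, h2⟩, by simpa using h3.trans hc.le⟩
          rcases h1 with h1 | h1
          · simp only [Option.some.injEq, Prod.mk.injEq] at h1
            obtain ⟨rfl, rfl⟩ := h1
            exact .inr ⟨.inl rfl, hk⟩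
          · exact .inr ⟨.inr h1.1, h1.2⟩
        · rw [hlt _ _ hw hv₀, not_lt] at hc
          obtain ⟨h1, h2, h3⟩ := ih hl (by simpa using hv₀) h
          have h3 : φ v ≤ φ v₀ := by simpa using h3
          refine ⟨by tauto, ⟨by simpa using h3.trans hc, h2⟩, by simpa using h3⟩

/-- Here `good` carries a bound on the length of the polynomials, since the cost of a comparison
depends on it. -/
theorem argmin_ticks_le {good : κ → Prop} {T U : ℕ} {l : List α}
    (hgood : ∀ a ∈ l, ∀ v, (key a).val = some v → good v)
    (hkey : ∀ a ∈ l, (key a).ticks ≤ T)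
    (hlt : ∀ v w, good v → good w → (lt v w).ticks ≤ U)
    {best : Option (α × κ)} (hbest : ∀ p, best = some p → good p.2) :
    (argmin key lt l best).ticks ≤ l.length * (T + U) := by
  induction l generalizing best with
  | nil => simp [argmin]
  | cons x l ih =>
    have hl : ∀ a ∈ l, ∀ v, (key a).val = some v → good v :=
      fun a ha => hgood a (List.mem_cons_of_mem _ ha)
    have ih := fun {best} => @ih hl (fun a ha => hkey a (List.mem_cons_of_mem _ ha)) best
    have hx := hgood x List.mem_cons_self
    have hT := hkey x List.mem_cons_self
    rw [List.length_cons]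
    cases hk : (key x).val with
    | none =>
      have := ih hbest
      simp only [argmin, Cost.ticks_bind, hk]
      linarith
    | some w =>
      have hw := hx w hk
      rcases best with _ | ⟨a₀, v₀⟩
      · have := @ih (some (x, w)) (by simpa using hw)
        simp only [argmin, Cost.ticks_bind, hk]
        linarith
      · have hv₀ : good v₀ := hbest _ rfl
        have hU := hlt _ _ hw hv₀
        simp only [argmin, Cost.ticks_bind, hk]
        split_ifs with hc
        · have := @ih (some (x, w)) (by simpa using hw)
          linarith
        · have := @ih (some (a₀, v₀)) (by simpa using hv₀)
          linarith

end argmin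

section sort

variable {α : Type} (e : α → ℕ)

theorem insertBy_perm (a : α) (l : List α) : (insertBy e a l).val.Perm (a :: l) := by
  induction l with
  | nil => simp [insertBy]
  | cons x l ih =>
    simp only [insertBy, Cost.val_bind, Cost.val_tick, decide_eq_true_eq]
    split_ifs
    · simp
    · exact (ih.cons x).trans (.swap _ _ _)

theorem insertBy_ticks_le (a : α) (l : List α) : (insertBy e a l).ticks ≤ l.length := by
  induction l with
  | nil => simp [insertBy]
  | cons x l ih =>
    simp only [insertBy, Cost.ticks_bind, Cost.val_tick, decide_eq_true_eq, Cost.ticks_tick]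
    split_ifs
    · simp
    · simp; omega

theorem insertBy_pairwise (a : α) {l : List α} (hl : l.Pairwise fun x y => e x < e y)
    (ha : ∀ x ∈ l, e a ≠ e x) : (insertBy e a l).val.Pairwise fun x y => e x < e y := by
  induction l with
  | nil => simp [insertBy]
  | cons x l ih =>
    rw [List.pairwise_cons] at hl
    simp only [insertBy, Cost.val_bind, Cost.val_tick, decide_eq_true_eq]
    split_ifs with h
    · refine List.pairwise_cons.2 ⟨?_, List.pairwise_cons.2 hl⟩
      simp only [List.mem_cons, forall_eq_or_imp]
      exact ⟨h, fun y hy => h.trans (hl.1 y hy)⟩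
    · refine List.pairwise_cons.2 ⟨fun y hy => ?_, ih hl.2 fun y hy => ha y (List.mem_cons_of_mem _ hy)⟩
      rw [(insertBy_perm e a l).mem_iff, List.mem_cons] at hy
      rcases hy with rfl | hy
      · have := ha x List.mem_cons_self
        omega
      · exact hl.1 y hy

theorem sortBy_perm (l : List α) : (sortBy e l).val.Perm l := by
  induction l with
  | nil => simp [sortBy]
  | cons x l ih => exact (insertBy_perm e x _).trans (ih.cons x)

theorem sortBy_ticks_le (l : List α) : (sortBy e l).ticks ≤ l.length ^ 2 := by
  induction l with
  | nil => simp [sortBy]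
  | cons x l ih =>
    have h := insertBy_ticks_le e x (sortBy e l).val
    rw [(sortBy_perm e l).length_eq] at h
    simp only [sortBy, Cost.ticks_bind, List.length_cons]
    nlinarith

theorem sortBy_pairwise {l : List α} (hl : l.Pairwise fun x y => e x ≠ e y) :
    (sortBy e l).val.Pairwise fun x y => e x < e y := by
  induction l with
  | nil => simp [sortBy]
  | cons x l ih =>
    rw [List.pairwise_cons] at hl
    exact insertBy_pairwise e x (ih hl.2) fun y hy => hl.1 y ((sortBy_perm e l).mem_iff.1 hy)

end sort

end ShadowSimplex

/-! ### Polynomials in ε and their values at small ε -/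

namespace ShadowSimplex
open Filter Topology Asymptotics

@[simp] theorem Cost.val_ite {α : Type} (p : Prop) [Decidable p] (x y : Cost α) :
    (if p then x else y).val = if p then x.val else y.val := apply_ite _ _ _ _

@[simp] theorem Cost.ticks_ite {α : Type} (p : Prop) [Decidable p] (x y : Cost α) :
    (if p then x else y).ticks = if p then x.ticks else y.ticks := apply_ite _ _ _ _

@[simp] theorem scalar_sub (x y : ℝ) : Scalar.sub x y = ⟨x - y, 1⟩ := rfl
@[simp] theorem scalar_mul (x y : ℝ) : Scalar.mul x y = ⟨x * y, 1⟩ := rfl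
@[simp] theorem scalar_div (x y : ℝ) : Scalar.div x y = ⟨x / y, 1⟩ := rfl
@[simp] theorem scalar_lt (x y : ℝ) : Scalar.lt x y = ⟨decide (x < y), 1⟩ := rfl
@[simp] theorem scalar_zero : (Scalar.zero : ℝ) = 0 := rfl
@[simp] theorem scalar_one : (Scalar.one : ℝ) = 1 := rfl

/-- The value of a polynomial at `ε`. -/
def SparsePoly.eval (p : SparsePoly ℝ) (ε : ℝ) : ℝ := (p.map fun x => x.2 * ε ^ x.1).sum

/-- The exponents are strictly increasing. -/
def SparsePoly.IsSorted (p : SparsePoly ℝ) : Prop := p.Pairwise fun x y => x.1 < y.1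

@[simp] theorem SparsePoly.eval_nil (ε : ℝ) : SparsePoly.eval [] ε = 0 := rfl

@[simp] theorem SparsePoly.eval_cons (x : ℕ × ℝ) (p : SparsePoly ℝ) (ε : ℝ) :
    SparsePoly.eval (x :: p) ε = x.2 * ε ^ x.1 + p.eval ε := by
  simp [SparsePoly.eval]

theorem SparsePoly.eval_isLittleO {p : SparsePoly ℝ} {e : ℕ} (h : ∀ x ∈ p, e < x.1) :
    p.eval =o[𝓝[>] 0] fun ε : ℝ => ε ^ e := by
  induction p with
  | nil => exact isLittleO_zero _ _
  | cons x p ih =>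
    have h1 : (fun ε : ℝ => x.2 * ε ^ x.1) =o[𝓝[>] 0] fun ε : ℝ => ε ^ e :=
      ((isLittleO_pow_pow (h x List.mem_cons_self)).mono nhdsWithin_le_nhds).const_mul_left _
    have h2 := h1.add (ih fun y hy => h y (List.mem_cons_of_mem _ hy))
    exact h2.congr_left fun ε => (SparsePoly.eval_cons x p ε).symm

/-- The monomial of lowest exponent dominates near zero. Tails of both signs are allowed so that
each case of the lexicographic comparison is a direct instance. -/
theorem SparsePoly.eventually_pos {x : ℝ} (hx : 0 < x) {e : ℕ} {p q : SparsePoly ℝ}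
    (hp : ∀ y ∈ p, e < y.1) (hq : ∀ y ∈ q, e < y.1) :
    ∀ᶠ ε : ℝ in 𝓝[>] 0, 0 < x * ε ^ e + p.eval ε - q.eval ε := by
  have h := ((eval_isLittleO hp).sub (eval_isLittleO hq)).def (half_pos hx)
  filter_upwards [h, self_mem_nhdsWithin] with ε h hε
  have hε : 0 < ε ^ e := pow_pos hε e
  rw [Real.norm_eq_abs, Real.norm_eq_abs, abs_of_pos hε, abs_le] at h
  nlinarith [mul_pos hx hε]

theorem isNegOr_val (x : ℝ) (r : Cost Bool) :
    (isNegOr x r).val = if x < 0 then true else if 0 < x then false else r.val := by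
  simp [isNegOr]

theorem isPosOr_val (x : ℝ) (r : Cost Bool) :
    (isPosOr x r).val = if 0 < x then true else if x < 0 then false else r.val := by
  simp [isPosOr]

theorem isNegOr_ticks_le (x : ℝ) (r : Cost Bool) : (isNegOr x r).ticks ≤ 2 + r.ticks := by
  simp only [isNegOr, scalar_lt, scalar_zero, Cost.ticks_bind, Cost.ticks_ite, Cost.ticks_pure]
  split_ifs <;> omega

theorem isPosOr_ticks_le (x : ℝ) (r : Cost Bool) : (isPosOr x r).ticks ≤ 2 + r.ticks := by
  simp only [isPosOr, scalar_lt, scalar_zero, Cost.ticks_bind, Cost.ticks_ite, Cost.ticks_pure]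
  split_ifs <;> omega

/-- Each recursive call removes at least one monomial after at most four comparisons. -/
theorem polyLt_ticks_le (p q : SparsePoly ℝ) : (polyLt p q).ticks ≤ 4 * (p.length + q.length) := by
  induction p, q using polyLt.induct with
  | case1 => simp [polyLt]
  | case2 f y q ih =>
    have := isPosOr_ticks_le y (polyLt [] q)
    simp only [polyLt, List.length_cons] at *
    omega
  | case3 e x p ih =>
    have := isNegOr_ticks_le x (polyLt p [])
    simp only [polyLt, List.length_cons] at *
    omega
  | case4 e x p f y q ih1 ih2 ih3 =>
    have h1 := isNegOr_ticks_le x (polyLt p ((f, y) :: q))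
    have h2 := isPosOr_ticks_le y (polyLt ((e, x) :: p) q)
    simp only [polyLt, List.length_cons, Cost.ticks_bind, Cost.val_tick, Cost.ticks_tick,
      decide_eq_true_eq, scalar_lt, Cost.ticks_ite, Cost.ticks_pure] at *
    split_ifs <;> omega

/-- The lexicographic order compares the values for all small positive `ε`. -/
theorem polyLt_iff {p q : SparsePoly ℝ} (hp : p.IsSorted) (hq : q.IsSorted) :
    ∀ᶠ ε : ℝ in 𝓝[>] 0, ((polyLt p q).val = true ↔ p.eval ε < q.eval ε) := by
  unfold SparsePoly.IsSorted at hp hq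
  induction p, q using polyLt.induct with
  | case1 => simp [polyLt]
  | case2 f y q ih =>
    rw [List.pairwise_cons] at hq
    simp only [polyLt, isPosOr_val]
    rcases lt_trichotomy y 0 with h | rfl | h
    · filter_upwards [SparsePoly.eventually_pos (x := -y) (by linarith) (p := []) (by simp)
        hq.1] with ε hε
      simp only [SparsePoly.eval_nil, SparsePoly.eval_cons, h, h.not_gt, if_true, if_false] at *
      simp; linarith
    · filter_upwards [ih hp hq.2] with ε hε
      simpa using hε
    · filter_upwards [SparsePoly.eventually_pos h (q := []) hq.1 (by simp)] with ε hε
      simp only [SparsePoly.eval_nil, SparsePoly.eval_cons, h, if_true] at *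
      simp; linarith
  | case3 e x p ih =>
    rw [List.pairwise_cons] at hp
    simp only [polyLt, isNegOr_val]
    rcases lt_trichotomy x 0 with h | rfl | h
    · filter_upwards [SparsePoly.eventually_pos (x := -x) (by linarith) (p := []) (by simp)
        hp.1] with ε hε
      simp only [SparsePoly.eval_nil, SparsePoly.eval_cons, h, if_true] at *
      simp; linarith
    · filter_upwards [ih hp.2 hq] with ε hε
      simpa using hε
    · filter_upwards [SparsePoly.eventually_pos h (q := []) hp.1 (by simp)] with ε hε
      simp only [SparsePoly.eval_nil, SparsePoly.eval_cons, h, h.not_gt, if_true, if_false] at *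
      simp; linarith
  | case4 e x p f y q ih1 ih2 ih3 =>
    have hp' := List.pairwise_cons.1 hp
    have hq' := List.pairwise_cons.1 hq
    -- When the leading exponents differ, the whole polynomial with the larger one counts as a tail
    -- of higher order.
    have hle : ∀ {a : ℕ} {l : SparsePoly ℝ} {g : ℕ} {z : ℝ}, a < g →
        (∀ w ∈ l, g < w.1) → ∀ w ∈ (g, z) :: l, a < w.1 := by
      intro a l g z h h' w hw
      rcases List.mem_cons.1 hw with rfl | hw
      · exact h
      · exact h.trans (h' w hw)
    rcases lt_trichotomy e f with hef | rfl | hef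
    · have hv : (polyLt ((e, x) :: p) ((f, y) :: q)).val =
          (isNegOr x (polyLt p ((f, y) :: q))).val := by
        simp [polyLt, hef]
      rw [hv, isNegOr_val]
      rcases lt_trichotomy x 0 with h | rfl | h
      · filter_upwards [SparsePoly.eventually_pos (x := -x) (by linarith) (hle (z := y) hef hq'.1)
          hp'.1] with ε hε
        simp only [SparsePoly.eval_cons, h, if_true] at *
        simp; linarith
      · filter_upwards [ih1 hp'.2 hq] with ε hε
        simpa using hε
      · filter_upwards [SparsePoly.eventually_pos h hp'.1 (hle (z := y) hef hq'.1)] with ε hε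
        simp only [SparsePoly.eval_cons, h, h.not_gt, if_true, if_false] at *
        simp; linarith
    · have hv : (polyLt ((e, x) :: p) ((e, y) :: q)).val =
          if x < y then true else if y < x then false else (polyLt p q).val := by
        simp [polyLt]
      rw [hv]
      rcases lt_trichotomy x y with h | rfl | h
      · filter_upwards [SparsePoly.eventually_pos (x := y - x) (by linarith) hq'.1
          hp'.1] with ε hε
        simp only [SparsePoly.eval_cons, h, if_true] at *
        simp; linarith
      · filter_upwards [ih3 hp'.2 hq'.2] with ε hε
        simpa using hε
      · filter_upwards [SparsePoly.eventually_pos (x := x - y) (by linarith) hp'.1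
          hq'.1] with ε hε
        simp only [SparsePoly.eval_cons, h, h.not_gt, if_true, if_false] at *
        simp; linarith
    · have hv : (polyLt ((e, x) :: p) ((f, y) :: q)).val =
          (isPosOr y (polyLt ((e, x) :: p) q)).val := by
        simp [polyLt, hef, hef.not_gt]
      rw [hv, isPosOr_val]
      rcases lt_trichotomy y 0 with h | rfl | h
      · filter_upwards [SparsePoly.eventually_pos (x := -y) (by linarith) (hle (z := x) hef hp'.1)
          hq'.1] with ε hε
        simp only [SparsePoly.eval_cons, h, h.not_gt, if_true, if_false] at *
        simp; linarith
      · filter_upwards [ih2 hp hq'.2] with ε hε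
        simpa using hε
      · filter_upwards [SparsePoly.eventually_pos h hq'.1 (hle (z := x) hef hp'.1)] with ε hε
        simp only [SparsePoly.eval_cons, h, if_true] at *
        simp; linarith

end ShadowSimplex

/-! ### Coordinates in a basis, pivots and optimal bases -/

namespace ShadowSimplex
open scoped Matrix

variable {m n : ℕ} {A : Matrix (Fin m) (Fin n) ℝ} {b : Fin m → ℝ} {β : Fin n → Fin m}

/-- The coordinates of `y` with respect to the rows in `β`. -/
noncomputable def coord (A : Matrix (Fin m) (Fin n) ℝ) (β : Fin n → Fin m) (y : Fin n → ℝ) :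
    Fin n → ℝ :=
  y ᵥ* (A.submatrix β id)⁻¹

/-- The rows in `β` are linearly independent. -/
abbrev IsBasis (A : Matrix (Fin m) (Fin n) ℝ) (β : Fin n → Fin m) : Prop :=
  LinearIndependent ℝ fun k => A (β k)

theorem sum_smul_row (z : Fin n → ℝ) : ∑ k, z k • A (β k) = z ᵥ* A.submatrix β id := by
  rw [Matrix.vecMul_eq_sum]; rfl

theorem IsBasis.isUnit_det (h : IsBasis A β) : IsUnit (A.submatrix β id).det :=
  (Matrix.isUnit_iff_isUnit_det _).1 (Matrix.linearIndependent_rows_iff_isUnit.1 h)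

theorem IsBasis.injective (h : IsBasis A β) : Function.Injective β :=
  fun _ _ hkl => LinearIndependent.injective h (congrArg (fun j => A j) hkl)

theorem IsBasis.sum_coord (h : IsBasis A β) (y : Fin n → ℝ) :
    ∑ k, coord A β y k • A (β k) = y := by
  rw [sum_smul_row, coord, Matrix.vecMul_vecMul, Matrix.nonsing_inv_mul _ h.isUnit_det,
    Matrix.vecMul_one]

theorem IsBasis.coord_sum (h : IsBasis A β) (z : Fin n → ℝ) :
    coord A β (∑ k, z k • A (β k)) = z := by
  rw [sum_smul_row, coord, Matrix.vecMul_vecMul, Matrix.mul_nonsing_inv _ h.isUnit_det,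
    Matrix.vecMul_one]

theorem IsBasis.coord_injective (h : IsBasis A β) : Function.Injective (coord A β) := by
  intro y y' hy
  rw [← h.sum_coord y, ← h.sum_coord y', hy]

theorem coord_add (y y' : Fin n → ℝ) : coord A β (y + y') = coord A β y + coord A β y' :=
  Matrix.add_vecMul _ _ _

theorem coord_sub (y y' : Fin n → ℝ) : coord A β (y - y') = coord A β y - coord A β y' :=
  Matrix.sub_vecMul _ _ _

theorem coord_smul (r : ℝ) (y : Fin n → ℝ) : coord A β (r • y) = r • coord A β y :=
  Matrix.smul_vecMul _ _ _

theorem coord_zero : coord A β 0 = 0 := Matrix.zero_vecMul _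

theorem continuous_coord : Continuous (coord A β) := by
  unfold coord
  fun_prop

theorem IsBasis.coord_row (h : IsBasis A β) (k : Fin n) :
    coord A β (A (β k)) = Pi.single k 1 := by
  have := h.coord_sum (Pi.single k 1)
  simpa [Pi.single_apply, ite_smul] using this

theorem IsBasis.mem_basisCone (h : IsBasis A β) {y : Fin n → ℝ} :
    y ∈ basisCone A β ↔ ∀ k, 0 ≤ coord A β y k := by
  constructor
  · intro hy k
    induction hy using Submodule.span_induction with
    | mem x hx =>
      obtain ⟨l, rfl⟩ := hx
      simp only [h.coord_row, Pi.single_apply]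
      split_ifs <;> norm_num
    | zero => simp [coord_zero]
    | add x y _ _ hx hy => rw [coord_add]; exact add_nonneg hx hy
    | smul r x _ hx =>
      have : r • x = (r : ℝ) • x := rfl
      rw [this, coord_smul]
      exact mul_nonneg r.2 hx
  · intro hy
    rw [← h.sum_coord y]
    exact Submodule.sum_mem _ fun k _ =>
      (basisCone A β).smul_mem (hy k) (PointedCone.subset_hull ⟨k, rfl⟩)

/-- The value of the objective `y` at the basic point of `β`. -/
noncomputable def objective (A : Matrix (Fin m) (Fin n) ℝ) (b : Fin m → ℝ) (β : Fin n → Fin m)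
    (y : Fin n → ℝ) : ℝ :=
  ∑ k, coord A β y k * b (β k)

theorem IsBasis.dotProduct_eq_objective (h : IsBasis A β) {x : Fin n → ℝ}
    (hx : ∀ k, A (β k) ⬝ᵥ x = b (β k)) (y : Fin n → ℝ) : y ⬝ᵥ x = objective A b β y := by
  conv_lhs => rw [← h.sum_coord y]
  simp only [sum_dotProduct, smul_dotProduct, hx, smul_eq_mul, objective]

theorem IsBasis.exists_basic_point (h : IsBasis A β) (b : Fin m → ℝ) :
    ∃ x, ∀ k, A (β k) ⬝ᵥ x = b (β k) := by
  refine ⟨(A.submatrix β id)⁻¹ *ᵥ (b ∘ β), fun k => ?_⟩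
  have : (A.submatrix β id) *ᵥ ((A.submatrix β id)⁻¹ *ᵥ (b ∘ β)) = b ∘ β := by
    rw [Matrix.mulVec_mulVec, Matrix.mul_nonsing_inv _ h.isUnit_det, Matrix.one_mulVec]
  exact congrFun this k

/-- Eliminating the basic point leaves inequalities that are linear in `b`, hence polynomial in `ε`
after the perturbation. -/
theorem isFeasibleBasis_iff :
    IsFeasibleBasis A b β ↔ IsBasis A β ∧ ∀ j, objective A b β (A j) ≤ b j := by
  constructor
  · rintro ⟨h, x, hx, hxb⟩
    have h : IsBasis A β := h
    exact ⟨h, fun j => (h.dotProduct_eq_objective hxb (A j)).symm.trans_le (hx j)⟩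
  · rintro ⟨h, hj⟩
    obtain ⟨x, hx⟩ := IsBasis.exists_basic_point h b
    exact ⟨h, x, fun j => (h.dotProduct_eq_objective hx (A j)).trans_le (hj j), hx⟩

theorem sum_smul_update (z : Fin n → ℝ) (i : Fin n) (j : Fin m) :
    ∑ k, z k • A (Function.update β i j k) = ∑ k, z k • A (β k) + z i • (A j - A (β i)) := by
  rw [← sub_eq_iff_eq_add', ← Finset.sum_sub_distrib, Finset.sum_eq_single i]
  · simp [smul_sub]
  · intro k _ hk; simp [hk]
  · simp

theorem sum_mul_update (z : Fin n → ℝ) (i : Fin n) (j : Fin m) :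
    ∑ k, z k * b (Function.update β i j k) = ∑ k, z k * b (β k) + z i * (b j - b (β i)) := by
  rw [← sub_eq_iff_eq_add', ← Finset.sum_sub_distrib, Finset.sum_eq_single i]
  · simp [mul_sub]
  · intro k _ hk; simp [hk]
  · simp

theorem IsBasis.update (h : IsBasis A β) {i : Fin n} {j : Fin m} (hp : coord A β (A j) i ≠ 0) :
    IsBasis A (Function.update β i j) := by
  rw [IsBasis, Fintype.linearIndependent_iff]
  intro g hg
  rw [sum_smul_update] at hg
  have hc : ∀ k, g k + g i * (coord A β (A j) k - (Pi.single i 1 : Fin n → ℝ) k) = 0 := by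
    intro k
    have := congrFun (congrArg (coord A β) hg) k
    simpa [coord_add, h.coord_sum, coord_smul, coord_sub, h.coord_row, coord_zero] using this
  have hi : g i = 0 := by
    have := hc i
    simp only [Pi.single_eq_same] at this
    have : g i * coord A β (A j) i = 0 := by linarith
    exact (mul_eq_zero.1 this).resolve_right hp
  intro k
  simpa [hi] using hc k

/-- The right side is the formula of `eliminateRow`; this is why an elimination step carries the
tableau of a basis to that of the next one. -/
theorem IsBasis.coord_update (h : IsBasis A β) {i : Fin n} {j : Fin m}
    (hp : coord A β (A j) i ≠ 0) (y : Fin n → ℝ) :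
    coord A (Function.update β i j) y = fun k => if k = i then coord A β y i / coord A β (A j) i
      else coord A β y k - coord A β (A j) k * (coord A β y i / coord A β (A j) i) := by
  rw [← (h.update hp).coord_sum fun k => if k = i then coord A β y i / coord A β (A j) i
      else coord A β y k - coord A β (A j) k * (coord A β y i / coord A β (A j) i)]
  congr 1
  apply h.coord_injective
  rw [sum_smul_update, coord_add, h.coord_sum, coord_smul, coord_sub, h.coord_row]
  funext k
  by_cases hk : k = i
  · subst hk
    simp
    field_simp
    ring
  · simp [hk]
    ring

/-- The change is a quotient of coordinates times the slack of the entering row, so its sign can be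
read off. It yields feasibility after a pivot when `y` is a row, and improvement when `y` is an
objective. -/
theorem objective_update (h : IsBasis A β) {i : Fin n} {j : Fin m}
    (hp : coord A β (A j) i ≠ 0) (y : Fin n → ℝ) :
    objective A b (Function.update β i j) y = objective A b β y +
      coord A β y i / coord A β (A j) i * (b j - objective A b β (A j)) := by
  rw [objective, sum_mul_update, h.coord_update hp]
  set p := coord A β (A j) with hpdef
  set z := coord A β y with hz
  have h1 : ∀ k, (if k = i then z i / p i else z k - p k * (z i / p i)) * b (β k) =
      z k * b (β k) - z i / p i * (p k * b (β k)) + if k = i then z i / p i * b (β i) else 0 := by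
    intro k
    split_ifs with hk
    · subst hk; field_simp; ring
    · ring
  simp only [h1, Finset.sum_add_distrib, Finset.sum_sub_distrib, ← Finset.mul_sum,
    Finset.sum_ite_eq', Finset.mem_univ, if_true, objective, ← hpdef, ← hz]
  ring

/-- The ratio test preserves feasibility. -/
theorem IsFeasibleBasis.update (h : IsFeasibleBasis A b β) {i : Fin n} {j : Fin m}
    (hp : coord A β (A j) i < 0)
    (hmin : ∀ l, coord A β (A l) i < 0 →
      (objective A b β (A j) - b j) / coord A β (A j) i ≤
        (objective A b β (A l) - b l) / coord A β (A l) i) :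
    IsFeasibleBasis A b (Function.update β i j) := by
  rw [isFeasibleBasis_iff] at h ⊢
  obtain ⟨hβ, hf⟩ := h
  refine ⟨hβ.update hp.ne, fun l => ?_⟩
  rw [objective_update hβ hp.ne]
  have hj := hf j
  have hl := hf l
  have hr : 0 ≤ (objective A b β (A j) - b j) / coord A β (A j) i :=
    div_nonneg_of_nonpos (by linarith) hp.le
  -- The left side of row `l` grows by minus its pivot coordinate times the minimal ratio. Only rows
  -- with negative coordinate can become violated, and for them the minimality bounds the growth by
  -- the slack.
  have e1 : coord A β (A l) i / coord A β (A j) i * (b j - objective A b β (A j)) =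
      -(coord A β (A l) i) * ((objective A b β (A j) - b j) / coord A β (A j) i) := by ring
  rw [e1]
  rcases lt_or_ge (coord A β (A l) i) 0 with hneg | hpos
  · have := hmin l hneg
    have e2 := mul_le_mul_of_nonneg_left this (neg_nonneg.2 hneg.le)
    have e3 : -(coord A β (A l) i) * ((objective A b β (A l) - b l) / coord A β (A l) i) =
        b l - objective A b β (A l) := by
      rw [neg_mul, mul_div_cancel₀ _ hneg.ne]; ring
    linarith
  · nlinarith [mul_nonneg hpos hr]

/-- No constraint outside of a basis is tight at its basic point. -/
def IsNondegenerate (A : Matrix (Fin m) (Fin n) ℝ) (b : Fin m → ℝ) : Prop :=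
  ∀ β : Fin n → Fin m, IsBasis A β → ∀ j, (∀ k, β k ≠ j) → objective A b β (A j) ≠ b j

/-- The cone generated by all rows. -/
def rowCone (A : Matrix (Fin m) (Fin n) ℝ) : PointedCone ℝ (Fin n → ℝ) :=
  PointedCone.hull ℝ (Set.range fun i => A i)

/-- Coordinates are linear, so a sign shared by all rows passes to their cone. In contraposition, a
negative coordinate of `y` guarantees a candidate for the entering row. -/
theorem coord_nonneg_of_mem_rowCone {i : Fin n} (h : ∀ j, 0 ≤ coord A β (A j) i)
    {y : Fin n → ℝ} (hy : y ∈ rowCone A) : 0 ≤ coord A β y i := by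
  induction hy using Submodule.span_induction with
  | mem x hx => obtain ⟨l, rfl⟩ := hx; exact h l
  | zero => simp [coord_zero]
  | add x y _ _ hx hy => rw [coord_add]; exact add_nonneg hx hy
  | smul r x _ hx =>
    have : r • x = (r : ℝ) • x := rfl
    rw [this, coord_smul]
    exact mul_nonneg r.2 hx

theorem IsBasis.ne_of_coord_neg (h : IsBasis A β) {i : Fin n} {j : Fin m}
    (hp : coord A β (A j) i < 0) (k : Fin n) : β k ≠ j := by
  rintro rfl
  rw [h.coord_row, Pi.single_apply] at hp
  split_ifs at hp <;> linarith

/-- For a nondegenerate right-hand side, every objective in the cone of the rows has an optimal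
basis. -/
theorem exists_isOptimalBasis (hnd : IsNondegenerate A b) (hfeas : ∃ β, IsFeasibleBasis A b β)
    {y : Fin n → ℝ} (hy : y ∈ rowCone A) : ∃ β, IsOptimalBasis A b y β := by
  -- A feasible basis of largest value is optimal: at a negative coordinate, a pivot would increase
  -- the value, strictly because nondegeneracy makes the slack of the entering row positive.
  obtain ⟨β, hβ, hmax⟩ := Set.exists_max_image {β | IsFeasibleBasis A b β}
    (fun β => objective A b β y) (Set.toFinite _) hfeas
  have hβ' := (isFeasibleBasis_iff.1 hβ)
  refine ⟨β, hβ, hβ'.1.mem_basisCone.2 fun i => ?_⟩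
  by_contra! hi
  have hex : ∃ j, coord A β (A j) i < 0 := by
    by_contra! hc
    exact absurd (coord_nonneg_of_mem_rowCone hc hy) (not_le.2 hi)
  obtain ⟨j, hj, hmin⟩ := Set.exists_min_image {j | coord A β (A j) i < 0}
    (fun j => (objective A b β (A j) - b j) / coord A β (A j) i) (Set.toFinite _) hex
  have hj : coord A β (A j) i < 0 := hj
  have hle := hmax _ (hβ.update hj hmin)
  have hne := hnd β hβ'.1 j (hβ'.1.ne_of_coord_neg hj)
  have hlt : objective A b β (A j) < b j := lt_of_le_of_ne (hβ'.2 j) hne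
  have hle : objective A b (Function.update β i j) y ≤ objective A b β y := hle
  rw [objective_update hβ'.1 hj.ne] at hle
  have := mul_pos (div_pos_of_neg_of_neg hi hj) (sub_pos.2 hlt)
  linarith

end ShadowSimplex

/-! ### The triangulation by cones of feasible bases -/

namespace ShadowSimplex
open scoped Matrix

variable {m n : ℕ} {A : Matrix (Fin m) (Fin n) ℝ} {b b' : Fin m → ℝ} {β β' : Fin n → Fin m}

theorem IsFeasibleBasis.isBasis (h : IsFeasibleBasis A b β) : IsBasis A β := h.1

theorem IsBasis.isClosed_basisCone (h : IsBasis A β) :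
    IsClosed (basisCone A β : Set (Fin n → ℝ)) := by
  have : (basisCone A β : Set (Fin n → ℝ)) = coord A β ⁻¹' {z | ∀ k, 0 ≤ z k} := by
    ext y
    exact h.mem_basisCone
  rw [this]
  refine IsClosed.preimage continuous_coord ?_
  simp only [Set.ofPred_forall]
  exact isClosed_iInter fun k => isClosed_le continuous_const (continuous_apply k)

theorem row_mem_basisCone (k : Fin n) : A (β k) ∈ basisCone A β :=
  PointedCone.subset_hull ⟨k, rfl⟩

theorem IsBasis.span_basisCone (h : IsBasis A β) :
    Submodule.span ℝ (basisCone A β : Set (Fin n → ℝ)) = ⊤ := by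
  rw [eq_top_iff]
  intro y _
  rw [← h.sum_coord y]
  exact Submodule.sum_mem _ fun k _ =>
    Submodule.smul_mem _ _ (Submodule.subset_span (row_mem_basisCone k))

theorem IsBasis.isSimplicial_basisCone (h : IsBasis A β) : (basisCone A β).IsSimplicial :=
  ⟨_, Set.finite_range _, h.linearIndepOn_id, rfl⟩

theorem basisCone_le_rowCone : basisCone A β ≤ rowCone A :=
  Submodule.span_mono (by rintro _ ⟨k, rfl⟩; exact ⟨β k, rfl⟩)

/-- Two cones of feasible bases meet in a common face if the right-hand side is nondegenerate. -/
theorem inf_isFaceOf_basisCone (hnd : IsNondegenerate A b) (h : IsFeasibleBasis A b β)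
    (h' : IsFeasibleBasis A b β') :
    (basisCone A β ⊓ basisCone A β').IsFaceOf (basisCone A β) := by
  refine ⟨inf_le_left, fun {x y a} hx hy ha hxy => ⟨hx, ?_⟩⟩
  obtain ⟨hβ, v, hv, hvb⟩ := h
  obtain ⟨hβ', v', hv', hvb'⟩ := h'
  have hβ : IsBasis A β := hβ
  have hβ' : IsBasis A β' := hβ'
  -- Weak duality: the basic point of `γ` maximizes each objective in the cone of `γ`.
  have key : ∀ {γ : Fin n → Fin m} {u u' : Fin n → ℝ} {z : Fin n → ℝ}, IsBasis A γ →
      u' ∈ polyhedron A b → (∀ k, A (γ k) ⬝ᵥ u = b (γ k)) → z ∈ basisCone A γ →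
      z ⬝ᵥ u' ≤ z ⬝ᵥ u := by
    intro γ u u' z hγ hu' hu hz
    rw [← hγ.sum_coord z]
    simp only [sum_dotProduct, smul_dotProduct, hu]
    exact Finset.sum_le_sum fun k _ =>
      mul_le_mul_of_nonneg_left (hu' _) (hγ.mem_basisCone.1 hz k)
  have h1 := key hβ hv' hvb hx
  have h2 := key hβ hv' hvb hy
  have h3 := key hβ' hv hvb' hxy.2
  -- Neither `x` nor `y` prefers `v'` to `v`, but `a • x + y` does not prefer `v` to `v'`. As `a >
  -- 0`, equality holds for `x`.
  have h4 : x ⬝ᵥ v' = x ⬝ᵥ v := by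
    simp only [add_dotProduct, smul_dotProduct, smul_eq_mul] at h3
    nlinarith
  have h5 : ∑ k, coord A β x k * (b (β k) - A (β k) ⬝ᵥ v') = 0 := by
    have e1 : x ⬝ᵥ v' = ∑ k, coord A β x k * (A (β k) ⬝ᵥ v') := by
      conv_lhs => rw [← hβ.sum_coord x]
      simp only [sum_dotProduct, smul_dotProduct, smul_eq_mul]
    have e2 := hβ.dotProduct_eq_objective hvb x
    simp only [mul_sub, Finset.sum_sub_distrib]
    rw [← e1, h4, e2, objective, sub_self]
  have hx0 := hβ.mem_basisCone.1 hx
  rw [Finset.sum_eq_zero_iff_of_nonneg fun k _ => mul_nonneg (hx0 k) (sub_nonneg.2 (hv' _))] at h5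
  -- Complementary slackness: a row used by `x` with nonzero coefficient is tight at `v'`, so
  -- nondegeneracy makes it a member of `β'`.
  rw [← hβ.sum_coord x]
  refine Submodule.sum_mem _ fun k _ => ?_
  by_cases hk : coord A β x k = 0
  · rw [hk, zero_smul]; exact Submodule.zero_mem _
  · have h6 := (mul_eq_zero.1 (h5 k (Finset.mem_univ k))).resolve_left hk
    have h7 : ∃ l, β' l = β k := by
      by_contra! hc
      refine hnd β' hβ' (β k) hc ?_
      rw [← hβ'.dotProduct_eq_objective hvb']
      linarith
    obtain ⟨l, hl⟩ := h7
    rw [← hl]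
    exact (basisCone A β').smul_mem (hx0 k) (row_mem_basisCone l)

/-- A constraint tight inside a segment of the polyhedron is tight at both ends, and the constraints
of a basis determine a point. -/
theorem IsBasis.mem_vertices (h : IsBasis A β) {v : Fin n → ℝ} (hv : v ∈ polyhedron A b)
    (hvb : ∀ k, A (β k) ⬝ᵥ v = b (β k)) : v ∈ vertices A b := by
  refine mem_extremePoints.2 ⟨hv, fun x₁ h₁ x₂ h₂ hx => ?_⟩
  obtain ⟨s, t, hs, ht, hst, rfl⟩ := hx
  have hk : ∀ k, A (β k) ⬝ᵥ x₁ = b (β k) ∧ A (β k) ⬝ᵥ x₂ = b (β k) := by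
    intro k
    have e := hvb k
    have e1 := h₁ (β k)
    have e2 := h₂ (β k)
    simp only [dotProduct_add, dotProduct_smul, smul_eq_mul] at e
    have hs' : s = 1 - t := by linarith
    subst hs'
    constructor <;> nlinarith
  have heq : ∀ x, (∀ k, A (β k) ⬝ᵥ x = b (β k)) → x = s • x₁ + t • x₂ := by
    intro x hx
    refine dotProduct_eq _ _ fun y => ?_
    rw [dotProduct_comm, dotProduct_comm _ y, h.dotProduct_eq_objective hx,
      h.dotProduct_eq_objective hvb]
  exact ⟨heq _ fun k => (hk k).1, heq _ fun k => (hk k).2⟩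

/-- The cones of the feasible bases. -/
def feasibleCones (A : Matrix (Fin m) (Fin n) ℝ) (b : Fin m → ℝ) :
    Set (PointedCone ℝ (Fin n → ℝ)) :=
  basisCone A '' {β | IsFeasibleBasis A b β}

theorem support_feasibleCones (hnd : IsNondegenerate A b) (hfeas : ∃ β, IsFeasibleBasis A b β) :
    support (feasibleCones A b) = rowCone A := by
  refine Set.Subset.antisymm (Set.iUnion₂_subset ?_) fun y hy => ?_
  · rintro _ ⟨β, _, rfl⟩
    exact basisCone_le_rowCone
  · obtain ⟨β, hβ, hyβ⟩ := exists_isOptimalBasis hnd hfeas hy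
    exact Set.mem_iUnion₂.2 ⟨_, ⟨β, hβ, rfl⟩, hyβ⟩

theorem basisCone_subset_normalFanSupport (h : IsFeasibleBasis A b β) :
    (basisCone A β : Set (Fin n → ℝ)) ⊆ normalFanSupport A b := by
  obtain ⟨hβ, v, hv, hvb⟩ := h
  refine Set.subset_iUnion₂_of_subset v (IsBasis.mem_vertices hβ hv hvb) ?_
  exact Submodule.span_mono (by rintro _ ⟨k, rfl⟩; exact ⟨β k, hvb k, rfl⟩)

theorem normalFanSupport_subset_rowCone : normalFanSupport A b ⊆ rowCone A :=
  Set.iUnion₂_subset fun v _ => Submodule.span_mono (by rintro _ ⟨k, _, rfl⟩; exact ⟨k, rfl⟩)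

/-- A nondegenerate perturbation of the right-hand side induces a triangulation of the normal
fan. -/
theorem isNormalFanTriangulation_feasibleCones (hnd : IsNondegenerate A b')
    (hfeas : ∃ β, IsFeasibleBasis A b' β)
    (hpert : ∀ β, IsFeasibleBasis A b' β → IsFeasibleBasis A b β) :
    IsNormalFanTriangulation A b (feasibleCones A b') := by
  have hfin : (feasibleCones A b').Finite := (Set.toFinite _).image _
  have hclosed : ∀ C ∈ feasibleCones A b', IsClosed (C : Set (Fin n → ℝ)) := by
    rintro _ ⟨β, hβ, rfl⟩
    exact hβ.isBasis.isClosed_basisCone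
  have hsupp := support_feasibleCones hnd hfeas
  refine { finite := hfin, isClosed := hclosed, full_dim := ?_, face := ?_, support_closed := ?_,
           simplicial := ?_, support_eq := ?_, generated := ?_ }
  · rintro _ ⟨β, hβ, rfl⟩
    exact hβ.isBasis.span_basisCone
  · rintro _ ⟨β, hβ, rfl⟩ _ ⟨β', hβ', rfl⟩ _
    exact ⟨inf_isFaceOf_basisCone hnd hβ hβ', inf_comm (basisCone A β) (basisCone A β') ▸
      inf_isFaceOf_basisCone hnd hβ' hβ⟩
  · exact ⟨rowCone A, hsupp.symm, hsupp ▸ hfin.isClosed_biUnion hclosed⟩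
  · rintro _ ⟨β, hβ, rfl⟩
    exact hβ.isBasis.isSimplicial_basisCone
  -- The support of the normal fan is squeezed: it contains all cones of feasible bases and lies in
  -- the cone of the rows, which these cones cover.
  · refine Set.Subset.antisymm (Set.iUnion₂_subset ?_) ?_
    · rintro _ ⟨β, hβ, rfl⟩
      exact basisCone_subset_normalFanSupport (hpert β hβ)
    · exact hsupp ▸ normalFanSupport_subset_rowCone
  · rintro _ ⟨β, hβ, rfl⟩
    obtain ⟨hβ, v, hv, hvb⟩ := hpert β hβ
    refine ⟨v, IsBasis.mem_vertices hβ hv hvb, Set.range β, ?_, ?_⟩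
    · rintro _ ⟨k, rfl⟩
      exact hvb k
    · rw [← Set.range_comp]
      rfl

/-! ### Facets of the cone of a basis -/

/-- The face of the cone of a basis opposite to one of the generators. -/
noncomputable def oppositeFacet (A : Matrix (Fin m) (Fin n) ℝ) (β : Fin n → Fin m) (i : Fin n) :
    PointedCone ℝ (Fin n → ℝ) :=
  basisCone A β ⊓ PointedCone.ofSubmodule
    { carrier := {y | coord A β y i = 0}
      add_mem' := fun {x y} hx hy => by
        simp only [Set.mem_ofPred_eq] at *
        simp [coord_add, hx, hy]
      zero_mem' := by simp [coord_zero]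
      smul_mem' := fun r x hx => by
        simp only [Set.mem_ofPred_eq] at *
        simp [coord_smul, hx] }

theorem mem_oppositeFacet {i : Fin n} {y : Fin n → ℝ} :
    y ∈ oppositeFacet A β i ↔ y ∈ basisCone A β ∧ coord A β y i = 0 := Iff.rfl

theorem IsBasis.row_mem_oppositeFacet (h : IsBasis A β) {i k : Fin n} (hk : k ≠ i) :
    A (β k) ∈ oppositeFacet A β i :=
  mem_oppositeFacet.2 ⟨row_mem_basisCone k, by rw [h.coord_row, Pi.single_eq_of_ne' hk]⟩

theorem IsBasis.isFacet_oppositeFacet (h : IsBasis A β) (i : Fin n) :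
    IsFacet (oppositeFacet A β i) (basisCone A β) := by
  refine ⟨⟨inf_le_left, fun {x y a} hx hy ha hxy => mem_oppositeFacet.2 ⟨hx, ?_⟩⟩, ?_⟩
  · have h1 := h.mem_basisCone.1 hx i
    have h2 := h.mem_basisCone.1 hy i
    have h3 := hxy.2
    change coord A β (a • x + y) i = 0 at h3
    simp only [coord_add, coord_smul, Pi.add_apply, Pi.smul_apply, smul_eq_mul] at h3
    nlinarith
  · have hspan : Submodule.span ℝ (oppositeFacet A β i : Set (Fin n → ℝ)) =
        Submodule.span ℝ (Set.range fun k : {k // k ≠ i} => A (β k)) := by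
      refine le_antisymm (Submodule.span_le.2 fun y hy => ?_) (Submodule.span_mono ?_)
      · rw [← h.sum_coord y]
        refine Submodule.sum_mem _ fun k _ => ?_
        by_cases hk : k = i
        · rw [hk, (mem_oppositeFacet.1 hy).2, zero_smul]
          exact Submodule.zero_mem _
        · exact Submodule.smul_mem _ _ (Submodule.subset_span ⟨⟨k, hk⟩, rfl⟩)
      · rintro _ ⟨k, rfl⟩
        exact h.row_mem_oppositeFacet k.2
    have hcard := finrank_span_eq_card
      (LinearIndependent.comp h (fun k : {k // k ≠ i} => k.1) Subtype.val_injective)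
    rw [hspan]
    erw [hcard]
    have : 0 < n := i.pos
    simp
    omega

/-- From a relatively interior point one can move a little in the direction `-A (β k)`, which lies
in the span of the facet. This lowers coordinate `k`, which must remain nonnegative. -/
theorem IsBasis.coord_pos_of_mem_intrinsicInterior (h : IsBasis A β) {i k : Fin n} (hk : k ≠ i)
    {x : Fin n → ℝ} (hx : x ∈ intrinsicInterior ℝ (oppositeFacet A β i : Set (Fin n → ℝ))) :
    0 < coord A β x k := by
  set F := oppositeFacet A β i
  have hxF : x ∈ F := intrinsicInterior_subset hx
  rw [mem_intrinsicInterior] at hx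
  obtain ⟨⟨x', hx'⟩, hint, rfl⟩ := hx
  have hline : ∀ t : ℝ, x' - t • A (β k) ∈ affineSpan ℝ (F : Set (Fin n → ℝ)) := by
    intro t
    have h0 : (0 : Fin n → ℝ) ∈ affineSpan ℝ (F : Set (Fin n → ℝ)) :=
      subset_affineSpan ℝ _ F.zero_mem
    have hr : A (β k) ∈ affineSpan ℝ (F : Set (Fin n → ℝ)) :=
      subset_affineSpan ℝ _ (h.row_mem_oppositeFacet hk)
    have := (affineSpan ℝ (F : Set (Fin n → ℝ))).smul_vsub_vadd_mem (-t) hr h0 hx'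
    simpa [sub_eq_add_neg, add_comm] using this
  have hcont : Continuous fun t : ℝ =>
      (⟨x' - t • A (β k), hline t⟩ : affineSpan ℝ (F : Set (Fin n → ℝ))) := by fun_prop
  have hnhds : ∀ᶠ t : ℝ in nhds 0, x' - t • A (β k) ∈ F := by
    have h1 : interior ((↑) ⁻¹' (F : Set (Fin n → ℝ)) : Set (affineSpan ℝ (F : Set (Fin n → ℝ)))) ∈
        nhds (⟨x' - (0 : ℝ) • A (β k), hline 0⟩ : affineSpan ℝ (F : Set (Fin n → ℝ))) :=
      isOpen_interior.mem_nhds (by simpa using hint)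
    filter_upwards [hcont.tendsto 0 h1] with t ht
    have := interior_subset (Set.mem_preimage.1 ht)
    exact this
  have hpos : ∃ t : ℝ, 0 < t ∧ x' - t • A (β k) ∈ F := by
    have := (hnhds.filter_mono nhdsWithin_le_nhds : ∀ᶠ t : ℝ in nhdsWithin 0 (Set.Ioi 0), _)
    exact (this.and self_mem_nhdsWithin).exists.imp fun t ht => ⟨ht.2, ht.1⟩
  obtain ⟨t, ht, htF⟩ := hpos
  have := h.mem_basisCone.1 (mem_oppositeFacet.1 htF).1 k
  simp only [coord_sub, coord_smul, h.coord_row, Pi.sub_apply, Pi.smul_apply, Pi.single_eq_same,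
    smul_eq_mul, mul_one] at this
  linarith

/-- Any step in the direction `-A (β i)` makes coordinate `i` negative and leaves the cone. -/
theorem IsBasis.oppositeFacet_subset_frontier (h : IsBasis A β) (i : Fin n) :
    (oppositeFacet A β i : Set (Fin n → ℝ)) ⊆ frontier (basisCone A β : Set (Fin n → ℝ)) := by
  intro x hx
  obtain ⟨hxC, hxi⟩ := mem_oppositeFacet.1 hx
  refine ⟨subset_closure hxC, fun hint => ?_⟩
  have hcont : Continuous fun t : ℝ => x - t • A (β i) := by fun_prop
  have hnhds : ∀ᶠ t : ℝ in nhds 0, x - t • A (β i) ∈ basisCone A β :=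
    hcont.tendsto 0 (by simpa using mem_interior_iff_mem_nhds.1 hint)
  have := (hnhds.filter_mono nhdsWithin_le_nhds : ∀ᶠ t : ℝ in nhdsWithin 0 (Set.Ioi 0), _)
  obtain ⟨t, htC, ht⟩ := (this.and self_mem_nhdsWithin).exists
  have ht : 0 < t := ht
  have := h.mem_basisCone.1 htC i
  simp only [coord_sub, coord_smul, h.coord_row, Pi.sub_apply, Pi.smul_apply, Pi.single_eq_same,
    smul_eq_mul, mul_one, hxi] at this
  linarith

end ShadowSimplex

/-! ### The setup: exponents and Gauss elimination -/

namespace ShadowSimplex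
open scoped Matrix

variable {m n : ℕ} {A : Matrix (Fin m) (Fin n) ℝ} {b : Fin m → ℝ} {β : Fin n → Fin m}

theorem position_eq_none {j : Fin m} : (position β j).val = none ↔ ∀ k, β k ≠ j := by
  simp [position, findFirst_val]

theorem position_eq_some {j : Fin m} {k : Fin n} (h : (position β j).val = some k) : β k = j := by
  rw [position, findFirst_val] at h
  simpa using List.find?_some h

theorem position_ticks_le (β : Fin n → Fin m) (j : Fin m) : (position β j).ticks ≤ n := by
  simpa [position] using findFirst_ticks_le (T := 1)
    (test := fun k => Cost.tick (decide (β k = j))) (fun k => le_rfl) (List.finRange n)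

theorem IsBasis.card_le (h : IsBasis A β) : n ≤ m := by
  simpa using Fintype.card_le_of_injective β h.injective

/-- The rows are numbered by distinct positive exponents, those outside of the initial basis
first. -/
theorem perturbation_spec (hβ : Function.Injective β) :
    (Function.Injective (perturbation β).val ∧ (∀ j, 0 < (perturbation β).val j) ∧
      ∀ j k, (∀ l, β l ≠ j) → (perturbation β).val j < (perturbation β).val (β k)) ∧
    (perturbation β).ticks ≤ m * (n + 1) := by
  classical
  have H := Cost.foldlM_induction (fun (s : ℕ × (Fin m → ℕ)) j => do
    match (← position β j) with
    | some k => pure (s.1, Function.update s.2 j (m - n + k + 1))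
    | none => do
      let i ← Cost.tick (s.1 + 1)
      pure (i, Function.update s.2 j i)) (n + 1) (List.finRange m)
    -- The counter is the number of rows outside of the basis seen so far and bounds their
    -- exponents, while basis rows get their final exponents at once.
    (fun l s => s.1 = (l.filter fun j => ∀ k, β k ≠ j).length ∧
      (∀ k, β k ∈ l → s.2 (β k) = m - n + k + 1) ∧
      (∀ j ∈ l, (∀ k, β k ≠ j) → 0 < s.2 j ∧ s.2 j ≤ s.1) ∧
      ∀ j ∈ l, ∀ j' ∈ l, (∀ k, β k ≠ j) → (∀ k, β k ≠ j') → s.2 j = s.2 j' → j = j')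
    (0, fun _ => 0) (by simp) ?_
  · obtain ⟨⟨h1, h2, h3, h4⟩, h5⟩ := H
    have hval : (perturbation β).val = ((List.finRange m).foldlM
      (fun (s : ℕ × (Fin m → ℕ)) j => do
        match (← position β j) with
        | some k => pure (s.1, Function.update s.2 j (m - n + k + 1))
        | none => do
          let i ← Cost.tick (s.1 + 1)
          pure (i, Function.update s.2 j i)) (0, fun _ => 0)).val.2 := rfl
    have hticks : (perturbation β).ticks ≤ m * (n + 1) := by
      simp only [List.length_finRange] at h5
      exact h5
    rw [← hval] at h2 h3 h4
    refine ⟨?_, hticks⟩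
    -- Hence exponents outside of the basis are at most `m - n`, below every `m - n + k + 1`.
    have hcard : ((List.finRange m).filter fun j => ∀ k, β k ≠ j).length + n ≤ m := by
      have hnd : (((List.finRange m).filter fun j => ∀ k, β k ≠ j) ++
          (List.finRange n).map β).Nodup := by
        refine List.Nodup.append ((List.nodup_finRange m).filter _)
          ((List.nodup_finRange n).map hβ) fun j hj hj' => ?_
        simp only [List.mem_filter, List.mem_map, decide_eq_true_eq] at hj hj'
        obtain ⟨k, -, hk⟩ := hj'
        exact hj.2 k hk
      simpa using hnd.length_le_card
    have h2 : ∀ k, (perturbation β).val (β k) = m - n + k + 1 := fun k => h2 k (List.mem_finRange _)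
    have h3 : ∀ j, (∀ k, β k ≠ j) → 0 < (perturbation β).val j ∧ (perturbation β).val j ≤ m - n := by
      intro j hj
      have := h3 j (List.mem_finRange _) hj
      omega
    have hlt : ∀ j k, (∀ l, β l ≠ j) → (perturbation β).val j < (perturbation β).val (β k) := by
      intro j k hj
      have := h3 j hj
      rw [h2]
      omega
    refine ⟨fun j j' hjj => ?_, fun j => ?_, hlt⟩
    · by_cases hj : ∃ k, β k = j <;> by_cases hj' : ∃ k, β k = j'
      · obtain ⟨k, rfl⟩ := hj
        obtain ⟨k', rfl⟩ := hj'
        rw [h2, h2] at hjj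
        congr 1
        ext
        omega
      · obtain ⟨k, rfl⟩ := hj
        push Not at hj'
        exact absurd hjj (hlt j' k hj').ne'
      · obtain ⟨k, rfl⟩ := hj'
        push Not at hj
        exact absurd hjj (hlt j k hj).ne
      · push Not at hj hj'
        exact h4 j (List.mem_finRange _) j' (List.mem_finRange _) hj hj' hjj
    · by_cases hj : ∃ k, β k = j
      · obtain ⟨k, rfl⟩ := hj
        rw [h2]
        omega
      · push Not at hj
        exact (h3 j hj).1
  · rintro l₁ a l₂ s hl ⟨h1, h2, h3, h4⟩
    have ha : a ∉ l₁ := by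
      have := hl ▸ List.nodup_finRange m
      rw [List.nodup_append] at this
      exact fun h => this.2.2 a h a List.mem_cons_self rfl
    have hne : ∀ j ∈ l₁, j ≠ a := fun j hj h => ha (h ▸ hj)
    have ht := position_ticks_le β a
    cases hp : (position β a).val with
    | some k =>
      obtain rfl := position_eq_some hp
      simp only [Cost.val_bind, hp, Cost.val_pure, Cost.ticks_bind, Cost.ticks_pure]
      refine ⟨⟨?_, ?_, ?_, ?_⟩, by omega⟩
      · simp [List.filter_append, h1]
      · intro k' hk'
        by_cases hkk : k' = k
        · subst hkk; simp
        · have hbk : β k' ≠ β k := fun h => hkk (hβ h)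
          rw [Function.update_of_ne hbk]
          simp only [List.mem_append, List.mem_singleton, hbk, or_false] at hk'
          exact h2 k' hk'
      · intro j hj hjk
        have hjb : j ≠ β k := (hjk k).symm
        rw [Function.update_of_ne hjb]
        simp only [List.mem_append, List.mem_singleton, hjb, or_false] at hj
        exact h3 j hj hjk
      · intro j hj j' hj' hjk hjk'
        have hjb : j ≠ β k := (hjk k).symm
        have hjb' : j' ≠ β k := (hjk' k).symm
        rw [Function.update_of_ne hjb, Function.update_of_ne hjb']
        simp only [List.mem_append, List.mem_singleton, hjb, hjb', or_false] at hj hj'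
        exact h4 j hj j' hj' hjk hjk'
    | none =>
      have hak := position_eq_none.1 hp
      simp only [Cost.val_bind, hp, Cost.val_pure, Cost.ticks_bind, Cost.ticks_pure, Cost.val_tick,
        Cost.ticks_tick]
      refine ⟨⟨?_, ?_, ?_, ?_⟩, by omega⟩
      · simp [List.filter_append, h1, hak]
      · intro k' hk'
        rw [Function.update_of_ne (hak k')]
        simp only [List.mem_append, List.mem_singleton, hak k', or_false] at hk'
        exact h2 k' hk'
      · intro j hj hjk
        simp only [List.mem_append, List.mem_singleton] at hj
        rcases hj with hj | rfl
        · rw [Function.update_of_ne (hne j hj)]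
          have := h3 j hj hjk
          omega
        · simp
      · intro j hj j' hj' hjk hjk'
        simp only [List.mem_append, List.mem_singleton] at hj hj'
        rcases hj with hj | rfl <;> rcases hj' with hj' | rfl
        · rw [Function.update_of_ne (hne j hj), Function.update_of_ne (hne j' hj')]
          exact h4 j hj j' hj' hjk hjk'
        · rw [Function.update_of_ne (hne j hj), Function.update_self]
          have := h3 j hj hjk
          omega
        · rw [Function.update_of_ne (hne j' hj'), Function.update_self]
          have := h3 j' hj' hjk'
          omega
        · simp

theorem eliminateRow_val (p : Fin n → ℝ) (k : Fin n) (r : Fin n → ℝ) :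
    (eliminateRow p k r).val =
      fun l => if l = k then r k / p k else r l - p l * (r k / p k) := by
  funext l
  simp [eliminateRow]

theorem eliminateRow_ticks_le (p : Fin n → ℝ) (k : Fin n) (r : Fin n → ℝ) :
    (eliminateRow p k r).ticks ≤ 4 * n := by
  have hn : 0 < n := k.pos
  have : (eliminateRow p k r).ticks ≤ 1 + n * 3 := by
    simp only [eliminateRow, Cost.ticks_bind, scalar_div]
    refine Nat.add_le_add_left (Cost.ticks_tabulate_le _ fun i => ?_) 1
    simp only [Cost.ticks_bind, Cost.ticks_tick, Cost.ticks_ite, Cost.ticks_pure, scalar_mul,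
      scalar_sub]
    split_ifs <;> omega
  omega

theorem eliminate_val (τ : Tableau ℝ m n) (j : Fin m) (k : Fin n) :
    (eliminate τ j k).val = ⟨fun i => (eliminateRow (τ.A j) k (τ.A i)).val,
      (eliminateRow (τ.A j) k τ.c).val, (eliminateRow (τ.A j) k τ.d).val⟩ := rfl

theorem eliminate_ticks_le (τ : Tableau ℝ m n) (j : Fin m) (k : Fin n) :
    (eliminate τ j k).ticks ≤ 12 * (m * n) := by
  have hm : 0 < m := j.pos
  have h1 := Cost.ticks_tabulate_le (fun i => eliminateRow (τ.A j) k (τ.A i))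
    (fun i => eliminateRow_ticks_le (τ.A j) k (τ.A i))
  have h2 := eliminateRow_ticks_le (τ.A j) k τ.c
  have h3 := eliminateRow_ticks_le (τ.A j) k τ.d
  simp only [eliminate, Cost.ticks_bind, Cost.ticks_pure]
  have : n ≤ m * n := Nat.le_mul_of_pos_left n hm
  nlinarith

/-- The tableau of a basis. -/
noncomputable def tableau (A : Matrix (Fin m) (Fin n) ℝ) (c d : Fin n → ℝ) (β : Fin n → Fin m) :
    Tableau ℝ m n :=
  ⟨fun i => coord A β (A i), coord A β c, coord A β d⟩

theorem eliminate_tableau (h : IsBasis A β) (c d : Fin n → ℝ) {i : Fin n} {j : Fin m}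
    (hp : coord A β (A j) i ≠ 0) :
    (eliminate (tableau A c d β) j i).val = tableau A c d (Function.update β i j) := by
  simp only [eliminate_val, eliminateRow_val, tableau, h.coord_update hp]

/-- The column operation of an elimination step. -/
noncomputable def eliminateMap (p : Fin n → ℝ) (k : Fin n) : (Fin n → ℝ) →ₗ[ℝ] (Fin n → ℝ) where
  toFun r l := if l = k then r k / p k else r l - p l * (r k / p k)
  map_add' r s := by
    funext l
    simp only [Pi.add_apply]
    split_ifs <;> ring
  map_smul' t r := by
    funext l
    simp only [Pi.smul_apply, smul_eq_mul, RingHom.id_apply]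
    split_ifs <;> ring

theorem eliminateMap_injective {p : Fin n → ℝ} {k : Fin n} (hp : p k ≠ 0) :
    Function.Injective (eliminateMap p k) := by
  rw [injective_iff_map_eq_zero]
  intro r hr
  have h0 : r k = 0 := by
    have := congrFun hr k
    simp only [eliminateMap, LinearMap.coe_mk, AddHom.coe_mk, if_true, Pi.zero_apply] at this
    exact (div_eq_zero_iff.1 this).resolve_right hp
  funext l
  have := congrFun hr l
  by_cases hl : l = k
  · rw [hl, h0]; rfl
  · simpa [eliminateMap, hl, h0] using this

theorem isNonzero_val (x : ℝ) : (isNonzero x).val = decide (x ≠ 0) := by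
  simp only [isNonzero, scalar_lt, scalar_zero, Cost.val_bind, Cost.val_ite, Cost.val_pure,
    decide_eq_true_eq]
  rcases lt_trichotomy x 0 with h | rfl | h
  · simp [h, h.ne]
  · simp
  · simp [h, h.ne', h.not_gt]

theorem isNonzero_ticks_le (x : ℝ) : (isNonzero x).ticks ≤ 2 := by
  simp only [isNonzero, scalar_lt, scalar_zero, Cost.ticks_bind, Cost.ticks_ite, Cost.ticks_pure]
  split_ifs <;> omega

theorem mem_prefix_finRange {l₁ l₂ : List (Fin n)} {k : Fin n}
    (h : List.finRange n = l₁ ++ k :: l₂) (i : Fin n) : i ∈ l₁ ↔ i < k := by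
  have hs : (l₁ ++ k :: l₂).Pairwise (· < ·) := h ▸ List.pairwise_lt_finRange n
  rw [List.pairwise_append, List.pairwise_cons] at hs
  have hi : i ∈ l₁ ++ k :: l₂ := h ▸ List.mem_finRange i
  constructor
  · exact fun hi => hs.2.2 i hi k List.mem_cons_self
  · intro hik
    rw [List.mem_append, List.mem_cons] at hi
    rcases hi with hi | rfl | hi
    · exact hi
    · exact absurd hik (lt_irrefl _)
    · exact absurd (hs.2.1.1 i hi) hik.not_gt

/-- The invariant is that the tableau is the image of the input under an injective linear map that
sends the processed basis rows to unit vectors. At the end this map can only be `coord A β`. A step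
costs at most `2 * n` for the pivot search and `12 * (m * n)` for the elimination. -/
theorem gauss_spec (h : IsBasis A β) (c d : Fin n → ℝ) :
    (gauss β ⟨A, c, d⟩).val = tableau A c d β ∧ (gauss β ⟨A, c, d⟩).ticks ≤ 14 * (m * n ^ 2) := by
  have H := Cost.foldlM_induction (fun (τ : Tableau ℝ m n) k => do
    match (← findFirst (fun l => isNonzero (τ.A (β k) l))
        ((List.finRange n).filter fun l => k ≤ l)) with
    | none => pure τ
    | some l => eliminate (swapColumns τ k l) (β k) k) (14 * (m * n)) (List.finRange n)
    (fun l τ => ∃ f : (Fin n → ℝ) →ₗ[ℝ] (Fin n → ℝ), Function.Injective f ∧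
      (∀ i, τ.A i = f (A i)) ∧ τ.c = f c ∧ τ.d = f d ∧ ∀ i ∈ l, f (A (β i)) = Pi.single i 1)
    ⟨A, c, d⟩ ⟨LinearMap.id, Function.injective_id, by simp⟩ ?_
  · obtain ⟨⟨f, hf, hA, hc, hd, hfβ⟩, ht⟩ := H
    refine ⟨?_, ?_⟩
    · have hcoord : ∀ y, coord A β y = f y := by
        intro y
        conv_rhs => rw [← h.sum_coord y, map_sum]
        simp only [map_smul, hfβ _ (List.mem_finRange _)]
        funext k
        simp [Finset.sum_apply, Pi.single_apply]
      have key : ∀ τ : Tableau ℝ m n, (∀ i, τ.A i = f (A i)) → τ.c = f c → τ.d = f d →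
          τ = tableau A c d β := by
        rintro ⟨A', c', d'⟩ hA hc hd
        obtain rfl : A' = fun i => f (A i) := funext hA
        simp_all [tableau]
      exact key _ hA hc hd
    · simp only [List.length_finRange] at ht
      calc (gauss β ⟨A, c, d⟩).ticks ≤ n * (14 * (m * n)) := ht
        _ = 14 * (m * n ^ 2) := by ring
  · rintro l₁ k l₂ τ hl ⟨f, hf, hA, hc, hd, hfβ⟩
    simp only [mem_prefix_finRange hl] at hfβ
    have ht := findFirst_ticks_le (fun l => isNonzero_ticks_le (τ.A (β k) l))
      ((List.finRange n).filter fun l => k ≤ l)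
    have hlen : ((List.finRange n).filter fun l => k ≤ l).length ≤ n := by
      simpa using List.length_filter_le (fun l => decide (k ≤ l)) (List.finRange n)
    have hnm : n ≤ m * n := Nat.le_mul_of_pos_left n (β k).pos
    cases hp : (findFirst (fun l => isNonzero (τ.A (β k) l))
        ((List.finRange n).filter fun l => k ≤ l)).val with
    | none =>
      exfalso
      rw [findFirst_val, List.find?_eq_none] at hp
      have hzero : ∀ l, k ≤ l → f (A (β k)) l = 0 := by
        intro l hl
        have := hp l (by simpa using hl)
        simpa [isNonzero_val, hA] using this
      -- Without a pivot, the image of row `β k` is supported on earlier columns, so the row would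
      -- be a combination of earlier basis rows.
      have hdep : A (β k) = ∑ i, (if i < k then f (A (β k)) i else 0) • A (β i) := by
        apply hf
        rw [map_sum]
        funext l
        have : ∀ i, (f ((if i < k then f (A (β k)) i else 0) • A (β i))) l =
            if i = l then (if l < k then f (A (β k)) l else 0) else 0 := by
          intro i
          rw [map_smul]
          by_cases hi : i < k
          · rw [hfβ i hi, if_pos hi]
            by_cases hil : i = l
            · subst hil; simp [hi]
            · simp [hil]
          · by_cases hil : i = l
            · subst hil; simp [hi]
            · simp [hi, hil]
        rw [Finset.sum_apply]
        simp only [this, Finset.sum_ite_eq', Finset.mem_univ, if_true]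
        split_ifs with hlk
        · rfl
        · exact hzero l (not_lt.1 hlk)
      have := congrArg (fun y => coord A β y k) hdep
      simp only [h.coord_sum, h.coord_row, Pi.single_eq_same, lt_irrefl, if_false] at this
      exact one_ne_zero this
    | some l =>
      simp only [Cost.val_bind, Cost.ticks_bind, hp]
      refine ⟨?_, ?_⟩
      · rw [findFirst_val] at hp
        have hne : f (A (β k)) l ≠ 0 := by
          have := List.find?_some hp
          simpa [isNonzero_val, hA] using this
        have hkl : k ≤ l := by
          have := List.mem_of_find?_eq_some hp
          simpa using this
        set g := (LinearMap.funLeft ℝ ℝ (Equiv.swap k l)).comp f with hg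
        have hgne : g (A (β k)) k ≠ 0 := by simpa [hg, LinearMap.funLeft] using hne
        have hgi : Function.Injective g :=
          (LinearMap.funLeft_injective_of_surjective ℝ ℝ _ (Equiv.swap k l).surjective).comp hf
        refine ⟨(eliminateMap (g (A (β k))) k).comp g,
          (eliminateMap_injective hgne).comp hgi, ?_, ?_, ?_, ?_⟩
        · intro i
          rw [eliminate_val]
          simp only [eliminateRow_val, swapColumns, hA]
          rfl
        · rw [eliminate_val]
          simp only [eliminateRow_val, swapColumns, hA, hc]
          rfl
        · rw [eliminate_val]
          simp only [eliminateRow_val, swapColumns, hA, hd]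
          rfl
        · intro i hi
          rw [List.mem_append, List.mem_singleton, mem_prefix_finRange hl] at hi
          rcases hi with hi | rfl
          -- The swapped columns `k ≤ l` both come after `i`, so earlier unit vectors survive the
          -- swap; their entry `0` at `k` lets them survive the elimination.
          · have hgi : g (A (β i)) = Pi.single i 1 := by
              funext x
              have : g (A (β i)) x = f (A (β i)) (Equiv.swap k l x) := rfl
              rw [this, hfβ i hi]
              rcases eq_or_ne x k with rfl | hxk
              · rw [Equiv.swap_apply_left, Pi.single_eq_of_ne (hi.trans_le hkl).ne',
                  Pi.single_eq_of_ne hi.ne']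
              · rcases eq_or_ne x l with rfl | hxl
                · rw [Equiv.swap_apply_right, Pi.single_eq_of_ne (hi.trans_le hkl).ne',
                  Pi.single_eq_of_ne hi.ne']
                · rw [Equiv.swap_apply_of_ne_of_ne hxk hxl]
            rw [LinearMap.comp_apply, hgi]
            funext x
            simp only [eliminateMap, LinearMap.coe_mk, AddHom.coe_mk, Pi.single_eq_of_ne hi.ne',
              zero_div, mul_zero, sub_zero]
            split_ifs with hx
            · rw [hx, Pi.single_eq_of_ne hi.ne']
            · rfl
          · rw [LinearMap.comp_apply]
            funext x
            simp only [eliminateMap, LinearMap.coe_mk, AddHom.coe_mk, div_self hgne, mul_one,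
              sub_self, Pi.single_apply]
      · have := eliminate_ticks_le (swapColumns τ k l) (β k) k
        omega

end ShadowSimplex

/-! ### Leaving and entering indices, and the choice of ε -/

namespace ShadowSimplex
open scoped Matrix
open Filter Topology

variable {m n : ℕ} {A : Matrix (Fin m) (Fin n) ℝ} {b : Fin m → ℝ} {β : Fin n → Fin m}

theorem leaving_key_val (τ : Tableau ℝ m n) (i : Fin n) :
    (do
      if (← Scalar.lt (τ.d i) (τ.c i)) then do
        let s ← Scalar.sub (τ.c i) (τ.d i)
        let r ← Scalar.div (τ.c i) s
        pure (some r)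
      else
        pure none : Cost (Option ℝ)).val =
      if τ.d i < τ.c i then some (τ.c i / (τ.c i - τ.d i)) else none := by
  simp

theorem leaving_eq_none {τ : Tableau ℝ m n} (h : (leaving τ).val = none) (i : Fin n) :
    ¬ τ.d i < τ.c i := by
  have := (argmin_eq_none h).2 i (List.mem_finRange i)
  rw [leaving_key_val] at this
  simpa using this

theorem leaving_eq_some {τ : Tableau ℝ m n} {i : Fin n} {r : ℝ}
    (h : (leaving τ).val = some (i, r)) :
    τ.d i < τ.c i ∧ r = τ.c i / (τ.c i - τ.d i) ∧
      ∀ k, τ.d k < τ.c k → r ≤ τ.c k / (τ.c k - τ.d k) := by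
  obtain ⟨h1, h2, -⟩ := argmin_eq_some (good := fun _ => True) (φ := id) (by simp)
    (fun v w _ _ => by simp) (by simp) h
  have h1 := h1.resolve_left (by simp)
  rw [leaving_key_val] at h1
  have h3 : τ.d i < τ.c i := by
    by_contra hc
    rw [if_neg hc] at h1
    simp at h1
  rw [if_pos h3] at h1
  refine ⟨h3, by simpa using h1.2.symm, fun k hk => ?_⟩
  exact h2 k (List.mem_finRange k) _ (by rw [leaving_key_val, if_pos hk])

theorem leaving_ticks_le (τ : Tableau ℝ m n) : (leaving τ).ticks ≤ 4 * n := by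
  have := argmin_ticks_le (good := fun _ : ℝ => True) (T := 3) (U := 1) (l := List.finRange n)
    (key := fun i => do
      if (← Scalar.lt (τ.d i) (τ.c i)) then do
        let s ← Scalar.sub (τ.c i) (τ.d i)
        let r ← Scalar.div (τ.c i) s
        pure (some r)
      else
        pure none) (lt := Scalar.lt) (best := none)
    (by simp) (fun i _ => by
      simp only [scalar_lt, scalar_sub, scalar_div, Cost.ticks_bind, Cost.ticks_ite,
        Cost.ticks_pure]
      split_ifs <;> omega) (by simp) (by simp)
  simp only [List.length_finRange] at this
  exact this.trans_eq (mul_comm _ _)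

theorem sum_fold {α : Type} (f g : α → ℝ) (l : List α) (s₀ : ℝ) :
    l.foldlM (fun s k => do
      let t ← Scalar.mul (f k) (g k)
      Scalar.add s t) s₀ =
    (⟨s₀ + (l.map fun k => f k * g k).sum, 2 * l.length⟩ : Cost ℝ) := by
  induction l generalizing s₀ with
  | nil => ext <;> simp
  | cons a l ih =>
    have := ih (s₀ + f a * g a)
    ext
    · exact (congrArg Cost.val this).trans (by simp [add_assoc])
    · refine (congrArg (fun x : Cost ℝ => 2 + x.ticks) this).trans ?_
      simp only [List.length_cons]
      ring

/-- The perturbed right-hand side. -/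
def perturbed (b : Fin m → ℝ) (e : Fin m → ℕ) (ε : ℝ) (j : Fin m) : ℝ := b j + ε ^ e j

section ratio

variable {e : Fin m → ℕ} {ord : List (Fin n)} {τ : Tableau ℝ m n} {i : Fin n} {j : Fin m}

theorem ratio_val : (ratio b e β ord τ i j).val =
    ((0, ∑ k, τ.A j k * b (β k) - b j) ::
      (insertBy Prod.fst (e j, (-1 : ℝ)) (ord.map fun k => (e (β k), τ.A j k))).val).map
        fun x => (x.1, x.2 / τ.A j i) := by
  simp only [ratio, sum_fold, scalar_sub, scalar_zero, scalar_one, scalar_div, Cost.val_bind,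
    Cost.mapM_val, Cost.val_pure, zero_add, zero_sub, Fin.sum_univ_def]

theorem ratio_length : (ratio b e β ord τ i j).val.length = ord.length + 2 := by
  rw [ratio_val, List.length_map, List.length_cons, (insertBy_perm _ _ _).length_eq]
  simp

theorem ratio_ticks_le : (ratio b e β ord τ i j).ticks ≤ 2 * n + 2 * ord.length + 4 := by
  simp only [ratio, sum_fold, scalar_sub, scalar_zero, scalar_one, scalar_div, Cost.ticks_bind,
    List.length_finRange]
  set p := insertBy Prod.fst (e j, (0 : ℝ) - 1) (ord.map fun k => (e (β k), τ.A j k)) with hp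
  have h1 : p.ticks ≤ ord.length := by
    have := insertBy_ticks_le Prod.fst (e j, (0 : ℝ) - 1) (ord.map fun k => (e (β k), τ.A j k))
    rwa [List.length_map] at this
  have h2 : p.val.length = ord.length + 1 := by
    rw [hp, (insertBy_perm _ _ _).length_eq]
    simp
  have h3 := Cost.mapM_ticks_le (T := 1) (f := fun x : ℕ × ℝ => do
    let y ← (⟨x.2 / τ.A j i, 1⟩ : Cost ℝ)
    pure (x.1, y)) (fun a => by simp)
    ((0, (0 + ((List.finRange n).map fun k => τ.A j k * b (β k)).sum) - b j) :: p.val)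
  rw [List.length_cons, h2] at h3
  omega

/-- The constant term comes first because exponents are positive, and the exponent of row `j` is new
because `j` is outside of the basis. -/
theorem ratio_isSorted (he : Function.Injective e) (he0 : ∀ j, 0 < e j)
    (hord : ord.Pairwise fun x y => e (β x) < e (β y)) (hj : ∀ k, β k ≠ j) :
    SparsePoly.IsSorted (ratio b e β ord τ i j).val := by
  rw [ratio_val, SparsePoly.IsSorted, List.pairwise_map, List.pairwise_cons]
  constructor
  · intro x hx
    rw [(insertBy_perm _ _ _).mem_iff, List.mem_cons, List.mem_map] at hx
    rcases hx with rfl | ⟨k, _, rfl⟩ <;> exact he0 _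
  · refine insertBy_pairwise _ _ ?_ ?_
    · rw [List.pairwise_map]
      exact hord
    · intro x hx
      obtain ⟨k, _, rfl⟩ := List.mem_map.1 hx
      exact fun h => hj k (he h).symm

theorem ratio_eval (hord : ord.Perm (List.finRange n)) (ε : ℝ) :
    SparsePoly.eval (ratio b e β ord τ i j).val ε =
      (∑ k, τ.A j k * perturbed b e ε (β k) - perturbed b e ε j) / τ.A j i := by
  have h1 : ∀ p : List (ℕ × ℝ), SparsePoly.eval (p.map fun x => (x.1, x.2 / τ.A j i)) ε =
      SparsePoly.eval p ε / τ.A j i := by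
    intro p
    induction p with
    | nil => simp
    | cons x p ih =>
      rw [List.map_cons, SparsePoly.eval_cons, SparsePoly.eval_cons, ih]
      ring
  have h2 : SparsePoly.eval
      (insertBy Prod.fst (e j, (-1 : ℝ)) (ord.map fun k => (e (β k), τ.A j k))).val ε =
      - ε ^ e j + ∑ k, τ.A j k * ε ^ e (β k) := by
    rw [SparsePoly.eval, ((insertBy_perm _ _ _).map _).sum_eq, List.map_cons, List.map_map,
      List.sum_cons, (hord.map _).sum_eq, Fin.sum_univ_def]
    simp [Function.comp_def]
  rw [ratio_val, h1, SparsePoly.eval_cons, h2]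
  simp only [perturbed, mul_add, Finset.sum_add_distrib]
  ring

end ratio

/-- The ratio of a row, for the tableau of a basis. -/
noncomputable def basisRatio (A : Matrix (Fin m) (Fin n) ℝ) (b : Fin m → ℝ) (e : Fin m → ℕ)
    (β : Fin n → Fin m) (i : Fin n) (j : Fin m) : SparsePoly ℝ :=
  (ratio b e β (sortBy (fun k => e (β k)) (List.finRange n)).val (tableau A 0 0 β) i j).val

theorem basisRatio_eval (e : Fin m → ℕ) (i : Fin n) (j : Fin m) (ε : ℝ) :
    (basisRatio A b e β i j).eval ε =
      (objective A (perturbed b e ε) β (A j) - perturbed b e ε j) / coord A β (A j) i :=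
  ratio_eval (sortBy_perm _ _) ε

theorem basisRatio_isSorted (hβ : Function.Injective β) {e : Fin m → ℕ}
    (he : Function.Injective e) (he0 : ∀ j, 0 < e j) (i : Fin n) {j : Fin m} (hj : ∀ k, β k ≠ j) :
    (basisRatio A b e β i j).IsSorted :=
  ratio_isSorted he he0 (sortBy_pairwise _ ((List.nodup_finRange n).imp fun hxy h =>
    hxy (hβ (he h)))) hj

/-- At `ε`, the method compares polynomials as it does symbolically. -/
def ComparesAt (A : Matrix (Fin m) (Fin n) ℝ) (b : Fin m → ℝ) (e : Fin m → ℕ) (ε : ℝ) : Prop :=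
  ∀ β : Fin n → Fin m, IsBasis A β → ∀ i j j', (∀ k, β k ≠ j) → (∀ k, β k ≠ j') →
    ((polyLt (basisRatio A b e β i j) (basisRatio A b e β i j')).val = true ↔
      (basisRatio A b e β i j).eval ε < (basisRatio A b e β i j').eval ε)

theorem eventually_comparesAt {e : Fin m → ℕ} (he : Function.Injective e) (he0 : ∀ j, 0 < e j) :
    ∀ᶠ ε : ℝ in 𝓝[>] 0, ComparesAt A b e ε := by
  simp only [ComparesAt, eventually_all]
  intro β hβ i j j' hj hj'
  exact polyLt_iff (basisRatio_isSorted hβ.injective he he0 i hj)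
    (basisRatio_isSorted hβ.injective he he0 i hj')

theorem entering_key_val (e : Fin m → ℕ) (ord : List (Fin n)) (τ : Tableau ℝ m n) (i : Fin n)
    (j : Fin m) :
    (do
      match (← position β j) with
      | some _ => pure none
      | none => do
        if (← Scalar.lt (τ.A j i) Scalar.zero) then do
          let p ← ratio b e β ord τ i j
          pure (some p)
        else
          pure none : Cost (Option (SparsePoly ℝ))).val =
      if (∀ k, β k ≠ j) ∧ τ.A j i < 0 then some (ratio b e β ord τ i j).val else none := by
  cases hp : (position β j).val with
  | none =>
    have := position_eq_none.1 hp
    simp [hp, this]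
  | some k =>
    have := position_eq_some hp
    have : ¬ ∀ k, β k ≠ j := fun h => h k this
    simp only [Cost.val_bind, hp, Cost.val_pure, this, false_and, if_false]

/-- The ratio reads only the matrix of the tableau. Therefore a single `ε` can be chosen before `c`
and `d` are known. -/
theorem ratio_tableau (e : Fin m → ℕ) (c d : Fin n → ℝ) (i : Fin n) (j : Fin m) :
    (ratio b e β (sortBy (fun k => e (β k)) (List.finRange n)).val (tableau A c d β) i j).val =
      basisRatio A b e β i j := rfl

theorem entering_eq_none {e : Fin m → ℕ} {c d : Fin n → ℝ} {i : Fin n} (hβ : IsBasis A β)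
    (h : (entering b e β (tableau A c d β) i).val = none) (j : Fin m) :
    0 ≤ coord A β (A j) i := by
  by_contra! hneg
  have := (entering_key_val _ _ _ _ _).symm.trans ((argmin_eq_none h).2 j (List.mem_finRange j))
  rw [if_pos ⟨hβ.ne_of_coord_neg hneg, hneg⟩] at this
  simp at this

theorem entering_eq_some {e : Fin m → ℕ} {c d : Fin n → ℝ} {i : Fin n} {ε : ℝ} (hβ : IsBasis A β)
    (hε : ComparesAt A b e ε) {j : Fin m} {p : SparsePoly ℝ}
    (h : (entering b e β (tableau A c d β) i).val = some (j, p)) :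
    coord A β (A j) i < 0 ∧ ∀ l, coord A β (A l) i < 0 →
      (objective A (perturbed b e ε) β (A j) - perturbed b e ε j) / coord A β (A j) i ≤
        (objective A (perturbed b e ε) β (A l) - perturbed b e ε l) / coord A β (A l) i := by
  obtain ⟨h1, h2, -⟩ := argmin_eq_some
    (good := fun p => ∃ j, (∀ k, β k ≠ j) ∧ p = basisRatio A b e β i j)
    (φ := fun p => SparsePoly.eval p ε) (fun j _ v hv => by
      replace hv := (entering_key_val _ _ _ _ _).symm.trans hv
      rw [ratio_tableau] at hv
      split_ifs at hv with hc
      · exact ⟨j, hc.1, by simpa using hv.symm⟩)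
    (by
      rintro _ _ ⟨j, hj, rfl⟩ ⟨j', hj', rfl⟩
      exact hε β hβ i j j' hj hj') (by simp) h
  have h1 := (h1.resolve_left (by simp)).2
  replace h1 := (entering_key_val _ _ _ _ _).symm.trans h1
  rw [ratio_tableau] at h1
  split_ifs at h1 with hc
  obtain rfl : basisRatio A b e β i j = p := by simpa using h1
  refine ⟨hc.2, fun l hl => ?_⟩
  have := h2 l (List.mem_finRange l) (basisRatio A b e β i l)
    ((entering_key_val _ _ _ _ _).trans (if_pos ⟨hβ.ne_of_coord_neg hl, hl⟩))
  simpa only [basisRatio_eval] using this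

theorem entering_ticks_le (hnm : n ≤ m) (hn : 0 < n) (e : Fin m → ℕ) (τ : Tableau ℝ m n)
    (i : Fin n) : (entering b e β τ i).ticks ≤ 35 * (m * n) := by
  have hlen : (sortBy (fun k => e (β k)) (List.finRange n)).val.length = n := by
    rw [(sortBy_perm _ _).length_eq, List.length_finRange]
  have hsort := sortBy_ticks_le (fun k => e (β k)) (List.finRange n)
  -- Per row: `n` to locate it in the basis, `1` for the sign and `4 * n + 4` for its ratio. A
  -- comparison of two polynomials with `n + 2` monomials costs at most `8 * n + 16`.
  have H := argmin_ticks_le (good := fun p : SparsePoly ℝ => p.length = n + 2) (T := 5 * n + 5)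
    (U := 8 * n + 16) (l := List.finRange m)
    (key := fun j => do
      match (← position β j) with
      | some _ => pure none
      | none => do
        if (← Scalar.lt (τ.A j i) Scalar.zero) then do
          let p ← ratio b e β (sortBy (fun k => e (β k)) (List.finRange n)).val τ i j
          pure (some p)
        else
          pure none) (lt := polyLt) (best := none)
    (fun j _ v hv => by
      rw [entering_key_val] at hv
      split_ifs at hv
      obtain rfl := Option.some.inj hv
      rw [ratio_length, hlen])
    (fun j _ => by
      have h1 := position_ticks_le β j
      have h2 := ratio_ticks_le (b := b) (e := e) (β := β) (τ := τ) (i := i) (j := j)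
        (ord := (sortBy (fun k => e (β k)) (List.finRange n)).val)
      rw [hlen] at h2
      rw [Cost.ticks_bind]
      cases hp : (position β j).val with
      | none =>
        simp only [scalar_lt, Cost.ticks_bind, Cost.ticks_ite, Cost.ticks_pure]
        split_ifs <;> omega
      | some k => simp only [Cost.ticks_pure]; omega)
    (fun v w hv hw => by
      have := polyLt_ticks_le v w
      omega) (by simp)
  have : (entering b e β τ i).ticks ≤ n ^ 2 + m * (5 * n + 5 + (8 * n + 16)) := by
    rw [List.length_finRange] at hsort H
    exact Nat.add_le_add hsort H
  nlinarith

/-- Sufficiently small perturbations. -/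
theorem eventually_isFeasibleBasis {e : Fin m → ℕ} (hβ : IsFeasibleBasis A b β)
    (he : ∀ j k, (∀ l, β l ≠ j) → e j < e (β k)) :
    ∀ᶠ ε : ℝ in 𝓝[>] 0, IsFeasibleBasis A (perturbed b e ε) β := by
  obtain ⟨h, hf⟩ := isFeasibleBasis_iff.1 hβ
  simp only [isFeasibleBasis_iff, eventually_and, eventually_all]
  refine ⟨Eventually.of_forall fun _ => h, fun j => ?_⟩
  by_cases hj : ∃ k, β k = j
  · obtain ⟨k, rfl⟩ := hj
    refine Eventually.of_forall fun ε => ?_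
    rw [objective, h.coord_row]
    simp [Pi.single_apply]
  · push Not at hj
    -- The perturbation changes the slack of row `j` by `ε ^ e j` minus monomials of larger
    -- exponent. Here it matters that the rows of the initial basis are numbered last.
    have := SparsePoly.eventually_pos (x := 1) one_pos (e := e j) (p := [])
      (q := (List.finRange n).map fun k => (e (β k), coord A β (A j) k)) (by simp) (by
        intro y hy
        obtain ⟨k, _, rfl⟩ := List.mem_map.1 hy
        exact he j k hj)
    filter_upwards [this] with ε hε
    have h1 : SparsePoly.eval ((List.finRange n).map fun k => (e (β k), coord A β (A j) k)) ε =
        ∑ k, coord A β (A j) k * ε ^ e (β k) := by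
      rw [SparsePoly.eval, List.map_map, Fin.sum_univ_def]
      rfl
    rw [h1, SparsePoly.eval_nil] at hε
    have h2 := hf j
    simp only [objective, perturbed, mul_add, Finset.sum_add_distrib] at h2 ⊢
    linarith

theorem tendsto_slack {e : Fin m → ℕ} (he0 : ∀ j, 0 < e j) (β : Fin n → Fin m) (j : Fin m) :
    Tendsto (fun ε : ℝ => perturbed b e ε j - objective A (perturbed b e ε) β (A j)) (𝓝[>] 0)
      (𝓝 (b j - objective A b β (A j))) := by
  have hc : Continuous fun ε : ℝ => perturbed b e ε j - objective A (perturbed b e ε) β (A j) := by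
    unfold objective perturbed
    fun_prop
  have := hc.tendsto 0
  have h0 : perturbed b e 0 = b := by
    funext j
    simp [perturbed, (he0 j).ne']
  rw [h0] at this
  exact this.mono_left nhdsWithin_le_nhds

/-- The slacks are continuous in `ε`, so a constraint strictly violated at `0` stays violated for
small `ε`; there are finitely many bases. -/
theorem eventually_isFeasibleBasis_of_perturbed {e : Fin m → ℕ} (he0 : ∀ j, 0 < e j) :
    ∀ᶠ ε : ℝ in 𝓝[>] 0, ∀ β : Fin n → Fin m, IsFeasibleBasis A (perturbed b e ε) β →
      IsFeasibleBasis A b β := by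
  rw [eventually_all]
  intro β
  by_cases hβ : IsFeasibleBasis A b β
  · exact Eventually.of_forall fun _ _ => hβ
  by_cases h : IsBasis A β
  · rw [isFeasibleBasis_iff] at hβ
    push Not at hβ
    obtain ⟨j, hj⟩ := hβ h
    filter_upwards [(tendsto_slack (A := A) (b := b) he0 β j).eventually_lt_const
      (sub_neg.2 hj)] with ε hε hf
    have := (isFeasibleBasis_iff.1 hf).2 j
    linarith
  · exact Eventually.of_forall fun _ hf => absurd hf.1 h

/-- The slack of a row outside of a basis is a polynomial in `ε` whose coefficient at `ε ^ e j` is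
`1`, because the exponents are distinct and positive. It has finitely many roots. -/
theorem eventually_isNondegenerate {e : Fin m → ℕ} (he : Function.Injective e)
    (he0 : ∀ j, 0 < e j) : ∀ᶠ ε : ℝ in 𝓝[>] 0, IsNondegenerate A (perturbed b e ε) := by
  simp only [IsNondegenerate, eventually_all]
  intro β hβ j hj
  set q : Polynomial ℝ := Polynomial.C (b j - objective A b β (A j)) + Polynomial.X ^ e j -
    ∑ k, Polynomial.C (coord A β (A j) k) * Polynomial.X ^ e (β k) with hq
  have hq0 : q ≠ 0 := by
    intro h0
    have hc : q.coeff (e j) = 1 := by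
      have : ∀ k, e j ≠ e (β k) := fun k h => hj k (he h).symm
      simp [hq, Polynomial.coeff_C, (he0 j).ne', Polynomial.finsetSum_coeff,
        Polynomial.coeff_X_pow, this]
    rw [h0, Polynomial.coeff_zero] at hc
    exact zero_ne_one hc
  have hfin := Polynomial.finite_setOfPred_isRoot hq0
  have hle : 𝓝[>] (0 : ℝ) ≤ cofinite :=
    (nhdsWithin_mono (0 : ℝ) (s := Set.Ioi 0) (t := {0}ᶜ) fun x hx => ne_of_gt hx).trans
      (nhdsNE_le_cofinite 0)
  filter_upwards [hle hfin.compl_mem_cofinite] with ε hε hobj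
  apply hε
  have heval : q.eval ε = perturbed b e ε j - objective A (perturbed b e ε) β (A j) := by
    simp only [hq, perturbed, objective, Polynomial.eval_sub, Polynomial.eval_add,
      Polynomial.eval_C, Polynomial.eval_pow, Polynomial.eval_X, Polynomial.eval_finsetSum,
      Polynomial.eval_mul, mul_add, Finset.sum_add_distrib]
    ring
  change q.eval ε = 0
  rw [heval, hobj, sub_self]

end ShadowSimplex

/-! ### The main loop along the segment -/

namespace ShadowSimplex
open scoped Matrix
open Filter Topology

variable {m n : ℕ} {A : Matrix (Fin m) (Fin n) ℝ} {b b' : Fin m → ℝ} {β : Fin n → Fin m}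
  {c d : Fin n → ℝ}

/-- The points of the segment from `c` to `d`. -/
def segmentPoint (c d : Fin n → ℝ) (μ : ℝ) : Fin n → ℝ := (1 - μ) • c + μ • d

theorem coord_segmentPoint (μ : ℝ) (k : Fin n) :
    coord A β (segmentPoint c d μ) k = (1 - μ) * coord A β c k + μ * coord A β d k := by
  simp [segmentPoint, coord_add, coord_smul]

theorem segmentPoint_mem_segment {μ : ℝ} (h0 : 0 ≤ μ) (h1 : μ < 1) :
    segmentPoint c d μ ∈ segment ℝ c d :=
  ⟨1 - μ, μ, by linarith, h0, by ring, rfl⟩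

/-- The segment from `c` to `d` leaves the cone of a feasible basis at the parameter `μ`. -/
def IsCrossing (A : Matrix (Fin m) (Fin n) ℝ) (b : Fin m → ℝ) (c d : Fin n → ℝ) (μ : ℝ)
    (β : Fin n → Fin m) (i : Fin n) : Prop :=
  0 ≤ μ ∧ μ < 1 ∧ IsFeasibleBasis A b β ∧ segmentPoint c d μ ∈ oppositeFacet A β i ∧
    coord A β d i < coord A β c i

/-- Along the segment the coordinate is affine and strictly decreasing, so it vanishes only once. -/
theorem IsCrossing.eq_of_coord {μ ν : ℝ} {i : Fin n} (h : IsCrossing A b c d μ β i)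
    (hν : coord A β (segmentPoint c d ν) i = 0) : μ = ν := by
  have h1 := (mem_oppositeFacet.1 h.2.2.2.1).2
  have h2 := h.2.2.2.2
  rw [coord_segmentPoint] at h1 hν
  have h3 : (μ - ν) * (coord A β c i - coord A β d i) = 0 := by linarith
  rcases mul_eq_zero.1 h3 with h4 | h4 <;> linarith

/-- The constant is `4 + 1 + 35 + 12`: leaving index, comparison with `1`, entering index,
elimination. -/
theorem iteration_ticks_le (hnm : n ≤ m) (hn : 0 < n) (b : Fin m → ℝ) (e : Fin m → ℕ)
    (s : State ℝ m n) : (iteration b e s).ticks ≤ 52 * (m * n) := by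
  have hm : 0 < m := hn.trans_le hnm
  have h0 : n ≤ m * n := Nat.le_mul_of_pos_left n hm
  have h1 := leaving_ticks_le s.tableau
  rw [iteration, Cost.ticks_bind]
  cases hl : (leaving s.tableau).val with
  | none => simp only [Cost.ticks_pure]; omega
  | some p =>
    obtain ⟨i, r⟩ := p
    have h2 := entering_ticks_le hnm hn (b := b) e (β := s.basis) s.tableau i
    simp only [scalar_lt, Cost.ticks_bind, Cost.ticks_ite, Cost.ticks_pure]
    split_ifs
    · cases hen : (entering b e s.basis s.tableau i).val with
      | none => simp only [Cost.ticks_pure]; omega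
      | some q =>
        have h3 := eliminate_ticks_le s.tableau q.1 i
        simp only [Cost.ticks_bind, Cost.ticks_pure]
        omega
    · omega

theorem iteration_val_of_leaving_none {e : Fin m → ℕ} {s : State ℝ m n}
    (h : (leaving s.tableau).val = none) : (iteration b e s).val = .optimal s.basis := by
  simp only [iteration, Cost.val_bind, h, Cost.val_pure]

theorem iteration_val_of_one_le {e : Fin m → ℕ} {s : State ℝ m n} {i : Fin n} {r : ℝ}
    (h : (leaving s.tableau).val = some (i, r)) (hr : 1 ≤ r) :
    (iteration b e s).val = .optimal s.basis := by
  simp [iteration, h, hr.not_gt]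

theorem iteration_val_of_lt_one {e : Fin m → ℕ} {s : State ℝ m n} {i : Fin n} {r : ℝ} {j : Fin m}
    {p : SparsePoly ℝ} (h : (leaving s.tableau).val = some (i, r)) (hr : r < 1)
    (hj : (entering b e s.basis s.tableau i).val = some (j, p)) :
    (iteration b e s).val =
      .next ⟨Function.update s.basis i j, (eliminate s.tableau j i).val⟩ := by
  simp [iteration, h, hr, hj]

/-- The main loop pivots at increasing parameters of the segment and ends in an optimal basis. -/
theorem exists_loop (hn : 0 < n) {e : Fin m → ℕ} {ε : ℝ} (hε : ComparesAt A b e ε)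
    (hpert : ∀ β, IsFeasibleBasis A (perturbed b e ε) β → IsFeasibleBasis A b β)
    (hgen : InGeneralPosition A b c d) (hd : d ∈ rowCone A) (β : Fin n → Fin m) (μ : ℝ)
    (hβ : IsFeasibleBasis A (perturbed b e ε) β) (hμ : μ < 1)
    (hmem : segmentPoint c d (max μ 0) ∈ basisCone A β)
    (hexit : ∀ i, coord A β d i < coord A β c i →
      μ < coord A β c i / (coord A β c i - coord A β d i)) :
    ∃ (β' : Fin n → Fin m) (t : ℕ) (S : Finset ℝ),
      Loop b e ⟨β, tableau A c d β⟩ β' t ∧ IsOptimalBasis A b d β' ∧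
      (∀ ν ∈ S, μ < ν ∧ ∃ γ i, IsCrossing A (perturbed b e ε) c d ν γ i) ∧
      t ≤ 52 * (m * n) * (S.card + 1) := by
  classical
  -- All candidates for crossing parameters, over all lists of `n` rows. The number of those beyond
  -- `μ` decreases with each pivot.
  let Λ : Finset ℝ := Finset.univ.image fun p : (Fin n → Fin m) × Fin n =>
    coord A p.1 c p.2 / (coord A p.1 c p.2 - coord A p.1 d p.2)
  induction hN : (Λ.filter fun ν => μ < ν).card using Nat.strong_induction_on
    generalizing β μ with
  | _ N ih =>
  have hb : IsBasis A β := hβ.isBasis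
  have hnm := hb.card_le
  have hticks := iteration_ticks_le hnm hn b e ⟨β, tableau A c d β⟩
  have hx := hb.mem_basisCone.1 hmem
  simp only [coord_segmentPoint] at hx
  have hmax1 : max μ 0 < 1 := max_lt hμ one_pos
  have hstay : ∀ k, coord A β c k ≤ coord A β d k → ∀ ν, max μ 0 ≤ ν →
      0 ≤ (1 - ν) * coord A β c k + ν * coord A β d k := by
    intro k hk ν hν
    have := hx k
    nlinarith
  have hhalt : (iteration b e ⟨β, tableau A c d β⟩).val = .optimal β →
      (∀ k, coord A β d k < coord A β c k →
        1 ≤ coord A β c k / (coord A β c k - coord A β d k)) →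
      ∃ (β' : Fin n → Fin m) (t : ℕ) (S : Finset ℝ),
        Loop b e ⟨β, tableau A c d β⟩ β' t ∧ IsOptimalBasis A b d β' ∧
        (∀ ν ∈ S, μ < ν ∧ ∃ γ i, IsCrossing A (perturbed b e ε) c d ν γ i) ∧
        t ≤ 52 * (m * n) * (S.card + 1) := by
    intro hit hle
    refine ⟨β, _, ∅, .halt (t := (iteration b e ⟨β, tableau A c d β⟩).ticks) (Cost.ext hit rfl),
      ⟨hpert β hβ, hb.mem_basisCone.2 fun k => ?_⟩, by simp, by simpa using hticks⟩
    rcases lt_or_ge (coord A β d k) (coord A β c k) with hk | hk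
    · have := hle k hk
      rw [le_div_iff₀ (by linarith)] at this
      linarith
    · simpa using hstay k hk 1 hmax1.le
  cases hl : (leaving (tableau A c d β)).val with
  | none =>
    exact hhalt (iteration_val_of_leaving_none hl) fun k hk =>
      absurd hk (leaving_eq_none hl k)
  | some p =>
    obtain ⟨i, r⟩ := p
    obtain ⟨hi, hr, hmin⟩ := leaving_eq_some hl
    simp only [tableau] at hi hr hmin
    rcases le_or_gt 1 r with hr1 | hr1
    · exact hhalt (iteration_val_of_one_le hl hr1) fun k hk => hr1.trans (hmin k hk)
    have hci : 0 < coord A β c i - coord A β d i := by linarith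
    have hri : r * (coord A β c i - coord A β d i) = coord A β c i := by
      rw [hr, div_mul_cancel₀ _ hci.ne']
    have hμr : μ < r := hr ▸ hexit i hi
    have hmaxr : max μ 0 ≤ r := by
      rw [hr, le_div_iff₀ hci]
      have := hx i
      linarith
    have hr0 : 0 ≤ r := (le_max_right _ _).trans hmaxr
    have hzero : coord A β (segmentPoint c d r) i = 0 := by
      rw [coord_segmentPoint]
      linarith
    have hfacet : segmentPoint c d r ∈ oppositeFacet A β i := by
      refine mem_oppositeFacet.2 ⟨hb.mem_basisCone.2 fun k => ?_, hzero⟩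
      rw [coord_segmentPoint]
      rcases lt_or_ge (coord A β d k) (coord A β c k) with hk | hk
      · have := hmin k hk
        rw [le_div_iff₀ (by linarith)] at this
        linarith
      · exact hstay k hk r hmaxr
    -- As the coordinate vanishes before `d` is reached, it is negative at `d`. This rules out the
    -- unbounded outcome, since `d` lies in the cone of the rows.
    have hdi : coord A β d i < 0 := by nlinarith
    have hne : segmentPoint c d r ≠ d := by
      intro h
      rw [h] at hzero
      linarith
    have hint := hgen β (hpert β hβ) _ (hb.isFacet_oppositeFacet i) _
      (segmentPoint_mem_segment hr0 hr1) hne hfacet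
    cases hen : (entering b e β (tableau A c d β) i).val with
    | none =>
      exact absurd (coord_nonneg_of_mem_rowCone (entering_eq_none hb hen) hd) hdi.not_ge
    | some q =>
      obtain ⟨j, q⟩ := q
      obtain ⟨hp, hratio⟩ := entering_eq_some hb hε hen
      have hβ₁ := hβ.update hp hratio
      have hcoord₁ := hb.coord_update hp.ne
      -- At the crossing point the pivot leaves the other coordinates unchanged, as coordinate `i`
      -- is zero, and general position makes them positive.
      have hpos : ∀ k, k ≠ i → 0 < coord A (Function.update β i j) (segmentPoint c d r) k := by
        intro k hk
        simp only [hcoord₁, hk, if_false, hzero, zero_div, mul_zero, sub_zero]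
        exact hb.coord_pos_of_mem_intrinsicInterior hk hint
      have hmem₁ : segmentPoint c d (max r 0) ∈ basisCone A (Function.update β i j) := by
        rw [max_eq_left hr0]
        refine hβ₁.isBasis.mem_basisCone.2 fun k => ?_
        by_cases hk : k = i
        · simp [hcoord₁, hk, hzero]
        · exact (hpos k hk).le
      have hexit₁ : ∀ k, coord A (Function.update β i j) d k < coord A (Function.update β i j) c k →
          r < coord A (Function.update β i j) c k /
            (coord A (Function.update β i j) c k - coord A (Function.update β i j) d k) := by
        intro k hk
        -- The negative pivot element reverses the direction of coordinate `i`, so it no longer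
        -- decreases; the others are still positive at `r` and vanish later, if at all.
        by_cases hki : k = i
        · subst hki
          simp only [hcoord₁, if_true, div_lt_div_right_of_neg hp] at hk
          linarith
        · have := hpos k hki
          rw [coord_segmentPoint] at this
          rw [lt_div_iff₀ (by linarith)]
          linarith
      have hcard : (Λ.filter fun ν => r < ν).card < N := by
        rw [← hN]
        refine Finset.card_lt_card (Finset.ssubset_iff_of_subset ?_ |>.2 ⟨r, ?_, ?_⟩)
        · exact Finset.monotone_filter_right _ fun ν _ hν => hμr.trans hν
        · exact Finset.mem_filter.2 ⟨Finset.mem_image.2 ⟨(β, i), Finset.mem_univ _, hr.symm⟩, hμr⟩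
        · simp
      obtain ⟨β', t, S, hloop, hopt, hS, ht⟩ := ih _ hcard _ r hβ₁ hr1 hmem₁ hexit₁ rfl
      have hrS : r ∉ S := fun h => lt_irrefl _ (hS r h).1
      refine ⟨β', _, insert r S, .step (t := (iteration b e ⟨β, tableau A c d β⟩).ticks)
        (Cost.ext ((iteration_val_of_lt_one hl hr1 hen).trans ?_) rfl) hloop, hopt, ?_, ?_⟩
      · rw [eliminate_tableau hb c d hp.ne]
      · intro ν hν
        rcases Finset.mem_insert.1 hν with rfl | hν
        · exact ⟨hμr, β, i, hr0, hr1, hβ, hfacet, hi⟩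
        · exact ⟨hμr.trans (hS ν hν).1, (hS ν hν).2⟩
      · rw [Finset.card_insert_of_notMem hrS]
        linarith

/-- Different parameters give different points, because the coordinate that vanishes at a crossing
has a single zero on the segment. -/
theorem card_le_crossingPoints {S : Finset ℝ} (hS : ∀ ν ∈ S, ∃ γ i, IsCrossing A b c d ν γ i) :
    (S.card : ℕ∞) ≤ (crossingPoints (feasibleCones A b) c d).encard := by
  have hinj : Set.InjOn (segmentPoint c d) S := by
    intro μ hμ ν _ h
    obtain ⟨γ, i, hc⟩ := hS μ hμ
    exact hc.eq_of_coord (h ▸ (mem_oppositeFacet.1 hc.2.2.2.1).2)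
  rw [← Set.encard_coe_eq_coe_finsetCard, ← hinj.encard_image]
  refine Set.encard_le_encard ?_
  rintro _ ⟨μ, hμ, rfl⟩
  obtain ⟨γ, i, h0, h1, hγ, hF, -⟩ := hS μ hμ
  exact ⟨segmentPoint_mem_segment h0 h1, Set.mem_iUnion₂.2
    ⟨_, ⟨γ, hγ, rfl⟩, hγ.isBasis.oppositeFacet_subset_frontier i hF⟩⟩

/-- One facet cannot serve two parameters, because its vanishing coordinate has a single zero on the
segment. Outside `S` the chosen facet is the irrelevant value `⊥`. -/
theorem card_le_crossedFacets {S : Finset ℝ} (hS : ∀ ν ∈ S, ∃ γ i, IsCrossing A b c d ν γ i) :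
    (S.card : ℕ∞) ≤ (crossedFacets (feasibleCones A b) c d).encard := by
  have hS' : ∀ ν : ℝ, ∃ F : PointedCone ℝ (Fin n → ℝ), ν ∈ S → ∃ γ i,
      F = oppositeFacet A γ i ∧ IsCrossing A b c d ν γ i := by
    intro ν
    by_cases hν : ν ∈ S
    · obtain ⟨γ, i, h⟩ := hS ν hν
      exact ⟨_, fun _ => ⟨γ, i, rfl, h⟩⟩
    · exact ⟨⊥, fun h => absurd h hν⟩
  choose F hF using hS'
  have hinj : Set.InjOn F S := by
    intro μ hμ ν hν h
    obtain ⟨γ, i, hFμ, hc⟩ := hF μ hμ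
    obtain ⟨γ', i', hFν, hc'⟩ := hF ν hν
    have hmem : segmentPoint c d ν ∈ oppositeFacet A γ i := by
      rw [← hFμ, h, hFν]
      exact hc'.2.2.2.1
    exact hc.eq_of_coord (mem_oppositeFacet.1 hmem).2
  rw [← Set.encard_coe_eq_coe_finsetCard, ← hinj.encard_image]
  refine Set.encard_le_encard ?_
  rintro _ ⟨μ, hμ, rfl⟩
  obtain ⟨γ, i, hFμ, h0, h1, hγ, hmem, -⟩ := hF μ hμ
  rw [hFμ]
  exact ⟨⟨_, ⟨γ, hγ, rfl⟩, hγ.isBasis.isFacet_oppositeFacet i⟩, _,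
    segmentPoint_mem_segment h0 h1, hmem⟩

end ShadowSimplex

/-! ### Choice of ε and the total cost -/

open ShadowSimplex in
theorem theorem11 :
    ∃ K : ℕ, ∀ (m n : ℕ), 0 < n →
      ∀ (A : Matrix (Fin m) (Fin n) ℝ) (b : Fin m → ℝ), A.rank = n →
      ∀ β : Fin n → Fin m, ShadowSimplex.IsFeasibleBasis A b β →
      ∃ T : Set (PointedCone ℝ (Fin n → ℝ)),
        ShadowSimplex.IsNormalFanTriangulation A b T ∧ ShadowSimplex.basisCone A β ∈ T ∧
        ∀ c d : Fin n → ℝ,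
          ShadowSimplex.IsOptimalBasis A b c β →
          d ∈ ShadowSimplex.normalFanSupport A b →
          ShadowSimplex.InGeneralPosition A b c d →
          ∃ (β' : Fin n → Fin m) (t : ℕ),
            ShadowSimplex.Computes A b c d β β' t ∧
            ShadowSimplex.IsOptimalBasis A b d β' ∧
            (t : ℕ∞) ≤ K * (m * n ^ 2 + (ShadowSimplex.crossingPoints T c d).encard * m * n) ∧
            (t : ℕ∞) ≤ K * (m * n ^ 2 + (ShadowSimplex.crossedFacets T c d).encard * m * n) := by
  -- The constant is `2 + 14 + 52`: numbering of the rows, Gauss elimination, and the iteration that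
  -- halts; each pivot costs another `52 * (m * n)`.
  refine ⟨68, fun m n hn A b _ β hβ => ?_⟩
  have hb : IsBasis A β := hβ.isBasis
  obtain ⟨⟨he, he0, hlast⟩, hpt⟩ := perturbation_spec hb.injective
  obtain ⟨ε, hε, hfeas, hpert, hnd⟩ := ((eventually_comparesAt (A := A) (b := b) he he0).and
    ((eventually_isFeasibleBasis hβ hlast).and
      ((eventually_isFeasibleBasis_of_perturbed (A := A) (b := b) he0).and
        (eventually_isNondegenerate (A := A) (b := b) he he0)))).exists
  refine ⟨feasibleCones A (perturbed b (perturbation β).val ε),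
    isNormalFanTriangulation_feasibleCones hnd ⟨β, hfeas⟩ hpert, ⟨β, hfeas, rfl⟩,
    fun c d hc hd hgen => ?_⟩
  have hc0 := hb.mem_basisCone.1 hc.2
  -- The loop invariant needs a parameter strictly before every exit. Since `c` may lie on a facet,
  -- the first exit may be at `0`, hence the start at `-1`; the point of the segment is then taken
  -- at `max (-1) 0 = 0`.
  obtain ⟨β', t, S, hloop, hopt, hS, ht⟩ := exists_loop hn hε hpert hgen
    (normalFanSupport_subset_rowCone hd) β (-1) hfeas (by norm_num)
    (by simpa [segmentPoint] using hc.2)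
    (fun i hi => by
      have : 0 ≤ coord A β c i / (coord A β c i - coord A β d i) :=
        div_nonneg (hc0 i) (by linarith)
      linarith)
  obtain ⟨hgv, hgt⟩ := gauss_spec hb c d
  have hcross := fun ν hν => (hS ν hν).2
  have htotal : (setup A c d β).ticks + t ≤ 68 * (m * n ^ 2 + S.card * m * n) := by
    have : (setup A c d β).ticks ≤ m * (n + 1) + 14 * (m * n ^ 2) := by
      have : (setup A c d β).ticks = (perturbation β).ticks + (gauss β ⟨A, c, d⟩).ticks := rfl
      omega
    have h1 : m * (n + 1) ≤ 2 * (m * n ^ 2) := by nlinarith [Nat.mul_le_mul_left m hn]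
    have h2 : m * n ≤ m * n ^ 2 := by nlinarith [Nat.mul_le_mul_left m hn]
    nlinarith
  have hbound : ∀ N : ℕ∞, (S.card : ℕ∞) ≤ N →
      (((setup A c d β).ticks + t : ℕ) : ℕ∞) ≤ (68 : ℕ) * (m * n ^ 2 + N * m * n) := by
    intro N hN
    calc (((setup A c d β).ticks + t : ℕ) : ℕ∞)
        ≤ ((68 * (m * n ^ 2 + S.card * m * n) : ℕ) : ℕ∞) := Nat.cast_le.2 htotal
      _ = (68 : ℕ) * (m * n ^ 2 + S.card * m * n) := by push_cast; rfl
      _ ≤ (68 : ℕ) * (m * n ^ 2 + N * m * n) := by gcongr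
  refine ⟨β', _, ⟨t, ?_, rfl⟩, hopt, hbound _ (card_le_crossingPoints hcross),
    hbound _ (card_le_crossedFacets hcross)⟩
  have hsetup : (setup A c d β).val = ((perturbation β).val, ⟨β, tableau A c d β⟩) := by
    rw [← hgv]
    rfl
  rw [hsetup]
  exact hloop
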